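/- Let $G=(V,E)$ be a finite simple graph on $n$ vertices containing exactly one cycle ($G$ need not be connected). For a vertex $v$ of the cycle, the tree rooted at $v$ is the connected component of $v$ in the graph obtained from $G$ by deleting the edges of the cycle; it is non-trivial if it has more than one vertex. Let $r$ be the number of cycle vertices whose rooted tree is non-trivial, and suppose $r\ge1$. Let $\mathbf X_G=\sum_{\kappa}\prod_{v\in V}x_{\kappa(v)}$, summed over all proper colorings $\kappa:V\to\mathbb N$, be the chromatic symmetric function of $G$. Let $\mathfrak{st}_k$ be the chromatic symmetric function of the star graph on $k$ vertices, and for a partition $\lambda=(\lambda_1,\dots,\lambda_\ell)$ put $\mathfrak{st}_\lambda=\mathfrak{st}_{\lambda_1}\cdots\mathfrak{st}_{\lambda_\ell}$. Then $\mathbf X_G$ has a unique expansion $\mathbf X_G=\sum_{\lambda\vdash n}c_\lambda\,\mathfrak{st}_\lambda$ with $c_\lambda\in\mathbb Q$. Let $\lambda_{\mathrm{lead}}$ be the smallest partition $\lambda$ of $n$, in lexicographic order, with $c_\lambda\neq0$. For a graph $H$, an internal edge is an edge both of whose endpoints have degree at least $2$ in $H$, and $\lambda_{\mathrm{LC}}(H)$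 denotes the partition whose parts are the numbers of vertices of the leaf components of $H$, that is, of the connected components of the graph obtained from $H$ by deleting all its internal edges (and keeping all vertices). 1. If $r=1$, then $\lambda_{\mathrm{lead}}=\lambda_{\mathrm{LC}}(G\setminus e)$ for each of the two cycle edges $e$ incident to the root of the non-trivial tree, where $G\setminus e$ is $G$ with the edge $e$ deleted. 2. If $r\ge 2$, then $\lambda_{\mathrm{lead}}=\lambda_{\mathrm{LC}}(G)$. -/

import Mathlib

namespace StarLeading

/-- The chromatic symmetric function `∑_κ ∏_v x_{κ(v)}` over the proper colourings `κ : V → ℕ`, as a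
formal power series in the variables `x_0, x_1, …`: the coefficient of a monomial `x^m` is the number
of proper colourings that use the colour `i` exactly `m i` times, for every `i`. -/
noncomputable def csf {V : Type*} [Fintype V] (G : SimpleGraph V) : MvPowerSeries ℕ ℚ :=
  fun m => (Nat.card {κ : G.Coloring ℕ // ∑ v, Finsupp.single (κ v) 1 = m} : ℚ)

/-- The coefficients of `csf` count finite sets. -/
theorem finite_colorings {V : Type*} [Fintype V] (G : SimpleGraph V) (m : ℕ →₀ ℕ) :
    Finite {κ : G.Coloring ℕ // ∑ v, Finsupp.single (κ v) 1 = m} := by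
  have key : ∀ (κ : {κ : G.Coloring ℕ // ∑ v, Finsupp.single (κ v) 1 = m}) (v : V),
      κ.1 v ∈ m.support := by
    rintro ⟨κ, rfl⟩ v
    rw [Finsupp.mem_support_iff, Finsupp.finsetSum_apply]
    intro h
    have := (Finset.sum_eq_zero_iff.mp h) v (Finset.mem_univ v)
    simp at this
  refine Finite.of_injective
    (β := V → m.support) (fun κ v => ⟨κ.1 v, key κ v⟩) ?_
  intro κ κ' h
  apply Subtype.ext
  apply RelHom.ext
  intro v
  exact congrArg Subtype.val (congrFun h v)

/-- `st_k`, the chromatic symmetric function of the star graph on `k` vertices (for `k ≥ 1`). -/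
noncomputable def starSym (k : ℕ) : MvPowerSeries ℕ ℚ :=
  csf (SimpleGraph.starGraph (0 : Fin (k - 1 + 1)))

/-- `st_λ = st_{λ_1} st_{λ_2} ⋯ st_{λ_ℓ}`. -/
noncomputable def starBasis {n : ℕ} (lam : n.Partition) : MvPowerSeries ℕ ℚ :=
  (lam.parts.map starSym).prod

/-- `f = ∑_{λ ⊢ n} c_λ st_λ`. -/
def IsStarExpansion {n : ℕ} (f : MvPowerSeries ℕ ℚ) (c : n.Partition → ℚ) : Prop :=
  f = ∑ lam, c lam • starBasis lam

/-- The parts of a partition in weakly decreasing order. -/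
def partsList {n : ℕ} (lam : n.Partition) : List ℕ := lam.parts.sort (· ≥ ·)

/-- Lexicographic order: `μ = λ`, or at the first place where they differ `μ` has the smaller part. -/
def LexLE {n : ℕ} (mu lam : n.Partition) : Prop :=
  mu = lam ∨ List.Lex (· < ·) (partsList mu) (partsList lam)

/-- `lam` is the leading partition of `f`: `f` has exactly one star-expansion `f = ∑ c_λ st_λ`, and
`lam` is the lexicographically smallest partition whose coefficient in it is nonzero. -/
def IsLeadingPartition {n : ℕ} (f : MvPowerSeries ℕ ℚ) (lam : n.Partition) : Prop :=
  ∃ c : n.Partition → ℚ, IsStarExpansion f c ∧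
    (∀ c' : n.Partition → ℚ, IsStarExpansion f c' → c' = c) ∧
    c lam ≠ 0 ∧ ∀ mu, c mu ≠ 0 → LexLE lam mu

open Classical in
/-- The internal edges: both endpoints have degree at least two. -/
noncomputable def internalEdges {V : Type*} [Fintype V] (G : SimpleGraph V) : Set (Sym2 V) :=
  {e | e ∈ G.edgeSet ∧ ∀ v ∈ e, 2 ≤ G.degree v}

open Classical in
/-- The partition of `|V|` formed by the orders of the connected components of a graph. -/
noncomputable def componentPartition {V : Type*} [Fintype V] (H : SimpleGraph V) :
    (Fintype.card V).Partition where
  parts := (Finset.univ : Finset H.ConnectedComponent).val.map (fun K => K.supp.ncard)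
  parts_pos := by
    intro i hi
    obtain ⟨K, -, rfl⟩ := Multiset.mem_map.mp hi
    exact (Set.ncard_pos (Set.toFinite _)).mpr K.nonempty_supp
  parts_sum := by
    change ∑ K : H.ConnectedComponent, K.supp.ncard = Fintype.card V
    rw [← Finset.card_univ, Finset.card_eq_sum_card_fiberwise (f := H.connectedComponentMk)
      (t := Finset.univ) (by simp [Set.MapsTo])]
    refine Finset.sum_congr rfl fun K _ => ?_
    rw [← Set.ncard_coe_finset]
    congr 1
    ext v
    simp [SimpleGraph.ConnectedComponent.mem_supp_iff]

/-- `λ_LC(G)`, the partition of the orders of the leaf components, that is, of the connected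
components of `G` with its internal edges removed. -/
noncomputable def lambdaLC {V : Type*} [Fintype V] (G : SimpleGraph V) :
    (Fintype.card V).Partition :=
  componentPartition (G.deleteEdges (internalEdges G))

/-- The subgraph `C` of `G` is a cycle. -/
def IsCycleSubgraph {V : Type*} {G : SimpleGraph V} (C : G.Subgraph) : Prop :=
  ∃ (v : V) (p : G.Walk v v), p.IsCycle ∧ p.toSubgraph = C

/-- `G` contains exactly one cycle. -/
def IsUnicyclic {V : Type*} (G : SimpleGraph V) : Prop :=
  ∃! C : G.Subgraph, IsCycleSubgraph C

/-- The vertex set of the tree rooted at the vertex `v` of the cycle `C`: the connected component of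
`v` after the edges of the cycle are removed. -/
def rootedTree {V : Type*} {G : SimpleGraph V} (C : G.Subgraph) (v : V) : Set V :=
  ((G.deleteEdges C.edgeSet).connectedComponentMk v).supp

/-- The cycle vertices whose rooted tree is non-trivial (has more than one vertex). -/
def nontrivialRoots {V : Type*} {G : SimpleGraph V} (C : G.Subgraph) : Set V :=
  {v | v ∈ C.verts ∧ (rootedTree C v).Nontrivial}

end StarLeading

/-! Fix a map `ctr` hanging every leaf from its neighbour. The edges not used by `ctr` are the
internal ones, and the stars it forms are the leaf components. Inclusion–exclusion over the internal
edges only writes the chromatic symmetric function as a signed sum over sets `A` of internal edges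
made monochromatic, while leaf edges stay proper. Such a term factors over the blocks into which `A`
groups the centres: a block with k centres and l leaves gives ∑_c x_c^k (p₁ - x_c)^l. Expanding
x_c^(k-1) in powers of p₁ and p₁ - x_c turns this into stars (`restrictVars_starBlock`). The
partition of the leaf components then has coefficient 1 if no block contains two centres with leaves
("marked" centres) and 0 otherwise, and everything else is lexicographically larger
(`hasLead_starBlock`). Hence no smaller partition occurs, and the coefficient of the leaf-component
partition is `sepSum`, the sum of (-1)^|A| over the sets `A` separating the marked vertices.

The work lies in showing that this number is nonzero. Unmarked vertices on internal edges have
internal degree at least 2. Stripping pendant edges gives a recursion in which all terms have the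
sign (-1)^(number of vertices outside U), so nothing cancels and forests give a nonzero value
(`sepSum_forest`). With a cycle, the recursion ends at sums over the edges of the cycle
(`sepSum_strip`, `sepSum_cycle`); these vanish if at most one cycle vertex is in U and have the
right sign otherwise. Every non-trivial root is in U or can be brought into U by the recursion, so r
≥ 2 suffices.

For r = 1 that coefficient vanishes. Going round the cycle from the root instead, the edges are
released one at a time (`csf_eq_sum`). In the i-th term the first i edges are monochromatic and the
next is absent, so the following vertex becomes a leaf and a forest remains. The terms lead either
with the leaf partition of G minus the first edge, with a common sign, or with something larger.

Uniqueness of expansions holds because the star products span the power sum products, which are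
independent and equally many (`linearIndependent_starBasis`). -/

namespace StarLeading
-- Generating functions of colourings and their factorisation into blocks
open Finset
open scoped Classical

/-- The generating function, by content, of the maps `V → ℕ` satisfying `P`. -/
noncomputable def gen {V : Type*} [Fintype V] (P : (V → ℕ) → Prop) : MvPowerSeries ℕ ℚ :=
  fun m => (Nat.card {κ : V → ℕ // P κ ∧ ∑ v, Finsupp.single (κ v) 1 = m} : ℚ)

theorem csf_eq_gen {V : Type*} [Fintype V] (G : SimpleGraph V) :
    csf G = gen (fun κ : V → ℕ => ∀ a b, G.Adj a b → κ a ≠ κ b) := by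
  funext m
  simp only [csf, gen, Nat.cast_inj]
  exact Nat.card_congr
    { toFun := fun κ => ⟨fun v => κ.1 v, fun a b h => κ.1.valid h, κ.2⟩
      invFun := fun κ => ⟨SimpleGraph.Coloring.mk κ.1 (fun {a b} h => κ.2.1 a b h), κ.2.2⟩
      left_inv := fun κ => rfl
      right_inv := fun κ => rfl }

/-- Setting the variables outside `s` to zero. -/
noncomputable def restrictFun (s : Finset ℕ) (f : MvPowerSeries ℕ ℚ) : MvPowerSeries ℕ ℚ :=
  fun m => if m.support ⊆ s then MvPowerSeries.coeff m f else 0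

theorem coeff_restrictFun (s : Finset ℕ) (f : MvPowerSeries ℕ ℚ) (m : ℕ →₀ ℕ) :
    MvPowerSeries.coeff m (restrictFun s f) =
      if m.support ⊆ s then MvPowerSeries.coeff m f else 0 := rfl

/-- The ring homomorphism that sets the variables outside `s` to zero. -/
noncomputable def restrictVars (s : Finset ℕ) : MvPowerSeries ℕ ℚ →+* MvPowerSeries ℕ ℚ where
  toFun := restrictFun s
  map_zero' := by
    ext m
    simp [coeff_restrictFun]
  map_one' := by
    ext m
    rw [coeff_restrictFun, MvPowerSeries.coeff_one]
    split_ifs with h1 h2 h2 <;> simp_all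
  map_add' f g := by
    ext m
    rw [map_add]
    simp only [coeff_restrictFun]
    split_ifs <;> simp_all
  map_mul' f g := by
    ext m
    rw [MvPowerSeries.coeff_mul, coeff_restrictFun]
    split_ifs with h
    · rw [MvPowerSeries.coeff_mul]
      refine sum_congr rfl fun p hp => ?_
      have hp' := mem_antidiagonal.mp hp
      have h1 : p.1.support ⊆ s := fun i hi => h (by
        rw [← hp']; simp only [Finsupp.mem_support_iff, Finsupp.add_apply] at hi ⊢; omega)
      have h2 : p.2.support ⊆ s := fun i hi => h (by
        rw [← hp']; simp only [Finsupp.mem_support_iff, Finsupp.add_apply] at hi ⊢; omega)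
      simp only [coeff_restrictFun, h1, h2, if_true]
    · symm
      refine sum_eq_zero fun p hp => ?_
      have hp' := mem_antidiagonal.mp hp
      simp only [coeff_restrictFun]
      by_cases h1 : p.1.support ⊆ s
      · by_cases h2 : p.2.support ⊆ s
        · exfalso; apply h
          intro i hi
          rw [← hp'] at hi
          rcases mem_union.mp (Finsupp.support_add hi) with h' | h'
          exacts [h1 h', h2 h']
        · simp [h2]
      · simp [h1]

theorem coeff_restrictVars (s : Finset ℕ) (f : MvPowerSeries ℕ ℚ) (m : ℕ →₀ ℕ) :
    MvPowerSeries.coeff m (restrictVars s f) =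
      if m.support ⊆ s then MvPowerSeries.coeff m f else 0 := rfl

/-- Each coefficient involves finitely many variables. Identities can therefore be checked after
truncation, where the sum over colourings is a finite sum of monomials and x_c, p₁ can be handled as
polynomials. -/
theorem ext_restrictVars {f g : MvPowerSeries ℕ ℚ} (h : ∀ s, restrictVars s f = restrictVars s g) :
    f = g := by
  ext m
  have := congrArg (MvPowerSeries.coeff m) (h m.support)
  simpa [coeff_restrictVars] using this

theorem prod_X_eq_monomial {V : Type*} [Fintype V] (κ : V → ℕ) :
    ∏ v, (MvPowerSeries.X (κ v) : MvPowerSeries ℕ ℚ)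
      = MvPowerSeries.monomial (∑ v, Finsupp.single (κ v) 1) 1 := by
  simp only [MvPowerSeries.X_def]
  rw [MvPowerSeries.prod_monomial]
  simp

theorem restrictVars_gen {V : Type*} [Fintype V] (s : Finset ℕ) (P : (V → ℕ) → Prop) :
    restrictVars s (gen P) = ∑ κ ∈ (Fintype.piFinset fun _ : V => s) with P κ,
      ∏ v, (MvPowerSeries.X (κ v) : MvPowerSeries ℕ ℚ) := by
  ext m
  rw [coeff_restrictVars, map_sum]
  simp only [prod_X_eq_monomial, MvPowerSeries.coeff_monomial]
  have key : ∀ (κ : V → ℕ), ∑ v, Finsupp.single (κ v) 1 = m → ∀ v, κ v ∈ m.support := by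
    rintro κ rfl v
    rw [Finsupp.mem_support_iff, Finsupp.finsetSum_apply]
    intro h
    have := (Finset.sum_eq_zero_iff.mp h) v (Finset.mem_univ v)
    simp at this
  have key2 : ∀ (κ : V → ℕ), ∑ v, Finsupp.single (κ v) 1 = m → ∀ i ∈ m.support, ∃ v, κ v = i := by
    rintro κ rfl i hi
    by_contra! hcon
    rw [Finsupp.mem_support_iff, Finsupp.finsetSum_apply] at hi
    exact hi (Finset.sum_eq_zero fun v _ => by simp [hcon v])
  split_ifs with h
  · rw [Finset.sum_boole, MvPowerSeries.coeff_apply, gen]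
    congr 1
    rw [← Set.ncard_coe_finset, ← Nat.card_coe_set_eq]
    refine Nat.card_congr (Equiv.subtypeEquivRight fun κ => ?_)
    simp only [coe_filter, mem_filter, Fintype.mem_piFinset, Set.mem_ofPred_eq]
    exact ⟨fun hκ => ⟨⟨fun v => h (key κ hκ.2 v), hκ.1⟩, hκ.2.symm⟩,
      fun hκ => ⟨hκ.1.2, hκ.2.symm⟩⟩
  · symm
    refine sum_eq_zero fun κ hκ => ?_
    rw [if_neg]
    rintro rfl
    apply h
    intro i hi
    obtain ⟨v, rfl⟩ := key2 κ rfl i hi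
    exact Fintype.mem_piFinset.mp (mem_filter.mp hκ).1 v

theorem gen_congr {V : Type*} [Fintype V] {P Q : (V → ℕ) → Prop} (h : ∀ κ, P κ ↔ Q κ) :
    gen P = gen Q := by
  congr 1; funext κ; exact propext (h κ)

theorem gen_and_add_gen_and_not {V : Type*} [Fintype V] (P Q : (V → ℕ) → Prop) :
    gen (fun κ => P κ ∧ Q κ) + gen (fun κ => P κ ∧ ¬ Q κ) = gen P := by
  refine ext_restrictVars fun s => ?_
  rw [map_add, restrictVars_gen, restrictVars_gen, restrictVars_gen,
    ← sum_filter_add_sum_filter_not (filter P _) Q, filter_filter, filter_filter]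
  congr!

theorem gen_of_forall_not {V : Type*} [Fintype V] {P : (V → ℕ) → Prop} (h : ∀ κ, ¬ P κ) :
    gen P = 0 := by
  refine ext_restrictVars fun s => ?_
  rw [restrictVars_gen, map_zero, filter_false_of_mem fun κ _ => h κ, sum_empty]

/-- The map `κ` takes one value on the ends of `e`. -/
def Mono {V : Type*} (κ : V → ℕ) (e : Sym2 V) : Prop := (e.map κ).IsDiag

theorem mono_mk {V : Type*} (κ : V → ℕ) (a b : V) : Mono κ s(a, b) ↔ κ a = κ b := by
  simp [Mono]

/-- Induction on `I` with `P` general: the colourings monochromatic on the new edge are handled by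
the induction hypothesis for `P` strengthened by that condition. -/
theorem gen_inclusion_exclusion {V : Type*} [Fintype V] (I : Finset (Sym2 V)) :
    ∀ P : (V → ℕ) → Prop, gen (fun κ => P κ ∧ ∀ e ∈ I, ¬ Mono κ e) =
      ∑ A ∈ I.powerset, (-1 : ℚ) ^ A.card • gen (fun κ => P κ ∧ ∀ e ∈ A, Mono κ e) := by
  induction I using Finset.induction_on with
  | empty => intro P; simp
  | insert e I he ih =>
    intro P
    have h1 := gen_and_add_gen_and_not (fun κ => P κ ∧ ∀ e ∈ I, ¬ Mono κ e) (fun κ => Mono κ e)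
    have h2 := ih P
    have h3 := ih (fun κ => P κ ∧ Mono κ e)
    rw [sum_powerset_insert he]
    rw [gen_congr (Q := fun κ => (P κ ∧ ∀ e ∈ I, ¬ Mono κ e) ∧ ¬ Mono κ e)
      (fun κ => by simp only [forall_mem_insert]; tauto)]
    rw [gen_congr (Q := fun κ => (P κ ∧ Mono κ e) ∧ ∀ e ∈ I, ¬ Mono κ e)
      (fun κ => by tauto), h3, h2] at h1
    rw [eq_sub_of_add_eq' h1, sub_eq_add_neg, ← sum_neg_distrib]
    congr 1
    refine sum_congr rfl fun A hA => ?_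
    rw [card_insert_of_notMem (fun h => he (mem_powerset.mp hA h)), pow_succ, ← neg_smul]
    congr 1
    · ring
    · exact gen_congr fun κ => by simp only [forall_mem_insert]; tauto

/-- The power series `∑_c x_c^k (∑_{i ≠ c} x_i)^ℓ` restricted to the colours in `s`. -/
noncomputable def blockSum (s : Finset ℕ) (k l : ℕ) : MvPowerSeries ℕ ℚ :=
  ∑ c ∈ s, MvPowerSeries.X c ^ k * (∑ i ∈ s, MvPowerSeries.X i - MvPowerSeries.X c) ^ l

/-- Here `Z` marks the leaves and `π` gives the block. Once the common colour of the centres of each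
block is fixed, the vertices are coloured independently, so the sum is a product over blocks. -/
theorem restrictVars_gen_blocks {V ι : Type*} [Fintype V] [Fintype ι] (π : V → ι) (Z : V → Prop)
    (hπ : ∀ t, ∃ v, ¬ Z v ∧ π v = t) (s : Finset ℕ) :
    restrictVars s (gen fun κ : V → ℕ => ∃ γ : ι → ℕ, (∀ v, ¬ Z v → κ v = γ (π v)) ∧
      ∀ v, Z v → κ v ≠ γ (π v)) =
    ∏ t, blockSum s {v | ¬ Z v ∧ π v = t}.ncard {v | Z v ∧ π v = t}.ncard := by
  -- A chosen centre in each block; its colour determines `γ`, so the colourings can be fibred over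
  -- `γ`.
  choose r hr1 hr2 using hπ
  let S : (ι → ℕ) → V → Finset ℕ := fun γ v => if Z v then s.erase (γ (π v)) else {γ (π v)}
  rw [restrictVars_gen]
  have hmaps : ∀ κ ∈ ((Fintype.piFinset fun _ : V => s).filter fun κ => ∃ γ : ι → ℕ,
      (∀ v, ¬ Z v → κ v = γ (π v)) ∧ ∀ v, Z v → κ v ≠ γ (π v)),
      (fun t => κ (r t)) ∈ Fintype.piFinset fun _ : ι => s := fun κ hκ =>
    Fintype.mem_piFinset.mpr fun t => Fintype.mem_piFinset.mp (mem_filter.mp hκ).1 _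
  rw [← sum_fiberwise_of_maps_to hmaps]
  have hfib : ∀ γ ∈ Fintype.piFinset fun _ : ι => s,
      ((Fintype.piFinset fun _ : V => s).filter fun κ => ∃ γ : ι → ℕ,
      (∀ v, ¬ Z v → κ v = γ (π v)) ∧ ∀ v, Z v → κ v ≠ γ (π v)).filter
        (fun κ => (fun t => κ (r t)) = γ) = Fintype.piFinset (S γ) := by
    intro γ hγ
    ext κ
    simp only [mem_filter, Fintype.mem_piFinset, S]
    constructor
    · rintro ⟨⟨h1, γ', h2, h3⟩, rfl⟩ v
      have e : γ' (π v) = κ (r (π v)) := by rw [h2 _ (hr1 _), hr2]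
      split_ifs with hv
      · exact mem_erase.mpr ⟨fun h => h3 v hv (h.trans e.symm), h1 v⟩
      · exact mem_singleton.mpr ((h2 v hv).trans e)
    · intro h
      have h2 : ∀ v, ¬ Z v → κ v = γ (π v) := fun v hv => by simpa [hv] using h v
      have h3 : ∀ v, Z v → κ v ≠ γ (π v) ∧ κ v ∈ s := fun v hv => by simpa [hv] using h v
      refine ⟨⟨fun v => ?_, γ, h2, fun v hv => (h3 v hv).1⟩, ?_⟩
      · by_cases hv : Z v
        · exact (h3 v hv).2
        · rw [h2 v hv]; exact Fintype.mem_piFinset.mp hγ _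
      · funext t; rw [h2 _ (hr1 t), hr2]
  rw [sum_congr rfl fun γ hγ => by rw [hfib γ hγ]]
  simp only [blockSum]
  rw [prod_univ_sum]
  refine sum_congr rfl fun γ hγ => ?_
  rw [← prod_univ_sum]
  rw [← prod_fiberwise_of_maps_to (s := univ) (t := univ) (g := π) (fun _ _ => mem_univ _)]
  refine prod_congr rfl fun t _ => ?_
  rw [← prod_filter_mul_prod_filter_not _ (fun v => ¬ Z v)]
  congr 1
  · rw [prod_congr rfl (g := fun _ => (MvPowerSeries.X (γ t) : MvPowerSeries ℕ ℚ)), prod_const,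
      ← Set.ncard_coe_finset]
    · congr 2; ext v; simp [and_comm]
    · intro v hv
      simp only [mem_filter, mem_univ, true_and] at hv
      simp [S, hv.2, hv.1]
  · rw [prod_congr rfl
      (g := fun _ => (∑ i ∈ s, MvPowerSeries.X i - MvPowerSeries.X (γ t) : MvPowerSeries ℕ ℚ)),
      prod_const, ← Set.ncard_coe_finset]
    · congr 2; ext v; simp [and_comm]
    · intro v hv
      simp only [mem_filter, mem_univ, true_and, not_not] at hv
      simp only [S, hv.2, hv.1, if_true]
      rw [eq_sub_iff_add_eq, sum_erase_add]
      exact Fintype.mem_piFinset.mp hγ t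

/-- A star is a single block with one centre. -/
theorem restrictVars_starSym (s : Finset ℕ) (l : ℕ) :
    restrictVars s (starSym (l + 1)) = blockSum s 1 l := by
  have h := restrictVars_gen_blocks (V := Fin (l + 1)) (ι := Unit) (fun _ => ()) (fun v => v ≠ 0)
    (fun t => ⟨0, by simp⟩) s
  have e1 : {v : Fin (l + 1) | ¬ v ≠ 0 ∧ True}.ncard = 1 := by
    simp [Set.ncard_singleton]
  have e2 : {v : Fin (l + 1) | v ≠ 0 ∧ True}.ncard = l := by
    have : {v : Fin (l + 1) | v ≠ 0 ∧ True} = ({0} : Set (Fin (l + 1)))ᶜ := by ext; simp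
    rw [this, Set.ncard_compl]; simp
  simp only [univ_unique, prod_singleton] at h
  rw [e1, e2] at h
  rw [← h]
  congr 1
  rw [starSym, csf_eq_gen]
  refine gen_congr fun κ => ?_
  constructor
  · intro hκ
    refine ⟨fun _ => κ 0, by simp, fun v hv => hκ _ _ ?_⟩
    rw [SimpleGraph.starGraph_adj]; exact ⟨hv, Or.inr rfl⟩
  · rintro ⟨γ, h1, h2⟩ a b hab
    rw [SimpleGraph.starGraph_adj] at hab
    have h0 := h1 0 (by simp)
    rcases hab with ⟨hne, rfl | rfl⟩
    · intro h; exact h2 b (Ne.symm hne) (h ▸ h0)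
    · intro h; exact h2 a hne (h.trans h0)

/-- The star expansion of `∑_c x_c^k (∑_{i ≠ c} x_i)^ℓ`, for `k ≥ 1`. -/
noncomputable def starBlock (k l : ℕ) : MvPowerSeries ℕ ℚ :=
  ∑ j ∈ range k, ((-1 : ℚ) ^ j * ((k - 1).choose j : ℚ)) •
    (starSym 1 ^ (k - 1 - j) * starSym (1 + l + j))

theorem restrictVars_smul (s : Finset ℕ) (a : ℚ) (f : MvPowerSeries ℕ ℚ) :
    restrictVars s (a • f) = a • restrictVars s f := by
  ext m
  simp only [coeff_restrictVars, MvPowerSeries.coeff_smul]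
  split_ifs <;> simp

/-- One factor x of x^(k+1) is kept as the centre of a star; the rest is expanded as x^k = (p - (p -
x))^k, each factor p - x adding a leaf and each p a one-vertex star. -/
theorem restrictVars_starBlock (s : Finset ℕ) (k l : ℕ) :
    restrictVars s (starBlock (k + 1) l) = blockSum s (k + 1) l := by
  have h1 : blockSum s 1 0 = ∑ i ∈ s, (MvPowerSeries.X i : MvPowerSeries ℕ ℚ) := by simp [blockSum]
  have h2 : restrictVars s (starSym 1) = blockSum s 1 0 := restrictVars_starSym s 0
  simp only [starBlock, map_sum, restrictVars_smul, map_mul, map_pow,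
    show ∀ j, 1 + l + j = (l + j) + 1 by intro j; ring, restrictVars_starSym, h2]
  simp only [h1, Nat.add_sub_cancel]
  simp only [blockSum, pow_one]
  set p := ∑ i ∈ s, (MvPowerSeries.X i : MvPowerSeries ℕ ℚ)
  simp only [mul_sum, smul_sum]
  rw [sum_comm]
  refine sum_congr rfl fun c _ => ?_
  set x : MvPowerSeries ℕ ℚ := MvPowerSeries.X c
  have hx : x ^ k = ((-(p - x)) + p) ^ k := by ring
  rw [pow_succ, hx, add_pow, sum_mul, sum_mul]
  refine sum_congr rfl fun j _ => ?_
  rw [MvPowerSeries.smul_eq_C_mul]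
  rw [neg_pow (p - x)]
  simp only [map_mul, map_pow, map_neg, map_one, map_natCast]
  ring

theorem gen_blocks {V ι : Type*} [Fintype V] [Fintype ι] (π : V → ι) (Z : V → Prop)
    (hπ : ∀ t, ∃ v, ¬ Z v ∧ π v = t) :
    (gen fun κ : V → ℕ => ∃ γ : ι → ℕ, (∀ v, ¬ Z v → κ v = γ (π v)) ∧
      ∀ v, Z v → κ v ≠ γ (π v)) =
    ∏ t, starBlock {v | ¬ Z v ∧ π v = t}.ncard {v | Z v ∧ π v = t}.ncard := by
  refine ext_restrictVars fun s => ?_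
  rw [restrictVars_gen_blocks π Z hπ, map_prod]
  refine prod_congr rfl fun t _ => ?_
  obtain ⟨k, hk⟩ : ∃ k, {v | ¬ Z v ∧ π v = t}.ncard = k + 1 := by
    refine Nat.exists_eq_succ_of_ne_zero ?_
    exact ((Set.ncard_pos (Set.toFinite _)).mpr (hπ t)).ne'
  rw [hk, restrictVars_starBlock]

end StarLeading

/-! ### Leading terms in the lexicographic order -/

namespace StarLeading
open Finset
open scoped Classical

/-- `st_μ` for a multiset `μ`. -/
noncomputable def starProd (μ : Multiset ℕ) : MvPowerSeries ℕ ℚ := (μ.map starSym).prod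

theorem starProd_add (μ ν : Multiset ℕ) : starProd (μ + ν) = starProd μ * starProd ν := by
  simp [starProd]

/-- At the largest part whose multiplicities differ, `μ` has the larger multiplicity. -/
def MultLT (lam μ : Multiset ℕ) : Prop :=
  ∃ k, lam.count k < μ.count k ∧ ∀ j, k < j → lam.count j = μ.count j

theorem MultLT.add_right {lam μ : Multiset ℕ} (h : MultLT lam μ) (ν : Multiset ℕ) :
    MultLT (lam + ν) (μ + ν) := by
  obtain ⟨k, h1, h2⟩ := h
  exact ⟨k, by simpa using h1, fun j hj => by simp [h2 j hj]⟩

theorem MultLT.add_left {lam μ : Multiset ℕ} (h : MultLT lam μ) (ν : Multiset ℕ) :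
    MultLT (ν + lam) (ν + μ) := by
  rw [add_comm ν, add_comm ν]; exact h.add_right ν

theorem MultLT.trans {lam μ ν : Multiset ℕ} (h : MultLT lam μ) (h' : MultLT μ ν) :
    MultLT lam ν := by
  obtain ⟨k, h1, h2⟩ := h
  obtain ⟨k', h1', h2'⟩ := h'
  rcases lt_trichotomy k k' with hk | rfl | hk
  · exact ⟨k', (h2 _ hk).trans_lt h1', fun j hj => (h2 j (hk.trans hj)).trans (h2' j hj)⟩
  · exact ⟨k, h1.trans h1', fun j hj => (h2 j hj).trans (h2' j hj)⟩
  · exact ⟨k, h1.trans_eq (h2' _ hk), fun j hj => (h2 j hj).trans (h2' j (hk.trans hj))⟩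

theorem multLT_of_forall_lt {lam μ : Multiset ℕ} {k : ℕ} (h : ∀ i ∈ lam, i < k) (hk : k ∈ μ)
    (h' : ∀ i ∈ μ, i ≤ k) : MultLT lam μ :=
  ⟨k, by
    rw [Multiset.count_eq_zero_of_notMem fun hi => lt_irrefl _ (h k hi)]
    exact Multiset.count_pos.mpr hk, fun j hj => by
    rw [Multiset.count_eq_zero_of_notMem fun hi => lt_asymm hj (h j hi),
      Multiset.count_eq_zero_of_notMem fun hi => absurd (h' j hi) (not_le.mpr hj)]⟩

/-- Equal heads can be cancelled. A larger head `a` on the left is impossible: all parts on the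
right, `k` among them, are below `a`, so the counts of `a` would have to agree. -/
theorem lex_of_count : ∀ (l₁ l₂ : List ℕ), l₁.Pairwise (· ≥ ·) → l₂.Pairwise (· ≥ ·) →
    ∀ k, l₁.count k < l₂.count k → (∀ j, k < j → l₁.count j = l₂.count j) →
    List.Lex (· < ·) l₁ l₂
  | _, [], _, _, _, h, _ => by simp at h
  | [], _ :: _, _, _, _, _, _ => List.Lex.nil
  | a :: l₁, b :: l₂, h₁, h₂, k, hk, hj => by
    rcases lt_trichotomy a b with hab | rfl | hab
    · exact List.Lex.rel hab
    · refine List.Lex.cons (lex_of_count l₁ l₂ h₁.of_cons h₂.of_cons k ?_ fun j h => ?_)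
      · simpa [List.count_cons] using hk
      · simpa [List.count_cons] using hj j h
    · exfalso
      have hle : ∀ j ∈ b :: l₂, j ≤ b := by
        intro j hjm
        rcases List.mem_cons.mp hjm with rfl | hjm
        · exact le_rfl
        · exact List.rel_of_pairwise_cons h₂ hjm
      have hkm : k ∈ b :: l₂ := List.count_pos_iff.mp (by omega)
      have hka : k < a := (hle k hkm).trans_lt hab
      have h0 : (b :: l₂).count a = 0 :=
        List.count_eq_zero_of_not_mem fun h => absurd (hle a h) (not_le.mpr hab)
      have := hj a hka
      rw [h0] at this
      simp at this

theorem MultLT.lexLE {n : ℕ} {lam μ : n.Partition} (h : MultLT lam.parts μ.parts) :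
    LexLE lam μ := by
  obtain ⟨k, h1, h2⟩ := h
  refine Or.inr (lex_of_count _ _ ?_ ?_ k ?_ ?_)
  · exact Multiset.pairwise_sort _ _
  · exact Multiset.pairwise_sort _ _
  · simpa [partsList, ← Multiset.coe_count] using h1
  · intro j hj
    simpa [partsList, ← Multiset.coe_count] using h2 j hj

/-- The span of the `st_μ` with `μ` a partition of the same number as `lam` and larger. -/
noncomputable def higher (lam : Multiset ℕ) : Submodule ℚ (MvPowerSeries ℕ ℚ) :=
  Submodule.span ℚ {f | ∃ μ : Multiset ℕ, (∀ i ∈ μ, 0 < i) ∧ μ.sum = lam.sum ∧ MultLT lam μ ∧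
    f = starProd μ}

/-- `f` is `a • st_λ` up to a combination of larger `st_μ`. -/
def HasLead (f : MvPowerSeries ℕ ℚ) (a : ℚ) (lam : Multiset ℕ) : Prop :=
  f - a • starProd lam ∈ higher lam

theorem hasLead_one : HasLead 1 1 0 := by
  simp [HasLead, starProd]

theorem HasLead.add {f g : MvPowerSeries ℕ ℚ} {a b : ℚ} {lam : Multiset ℕ} (hf : HasLead f a lam)
    (hg : HasLead g b lam) : HasLead (f + g) (a + b) lam := by
  have := (higher lam).add_mem hf hg
  rw [HasLead, add_smul]
  convert this using 1
  abel

theorem HasLead.smul {f : MvPowerSeries ℕ ℚ} {a : ℚ} {lam : Multiset ℕ} (hf : HasLead f a lam)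
    (c : ℚ) : HasLead (c • f) (c * a) lam := by
  have := (higher lam).smul_mem c hf
  rwa [smul_sub, smul_smul] at this

theorem hasLead_zero (lam : Multiset ℕ) : HasLead 0 0 lam := by
  simp [HasLead]

theorem HasLead.sum {ι : Type*} (s : Finset ι) {f : ι → MvPowerSeries ℕ ℚ} {a : ι → ℚ}
    {lam : Multiset ℕ} (h : ∀ i ∈ s, HasLead (f i) (a i) lam) :
    HasLead (∑ i ∈ s, f i) (∑ i ∈ s, a i) lam := by
  induction s using Finset.induction_on with
  | empty => simpa using hasLead_zero lam
  | insert i s hi ih =>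
    rw [sum_insert hi, sum_insert hi]
    exact (h i (mem_insert_self i s)).add (ih fun j hj => h j (mem_insert_of_mem hj))

theorem starProd_mem_higher {lam μ : Multiset ℕ} (hμ : ∀ i ∈ μ, 0 < i) (hs : μ.sum = lam.sum)
    (h : MultLT lam μ) : starProd μ ∈ higher lam :=
  Submodule.subset_span ⟨μ, hμ, hs, h, rfl⟩

theorem HasLead.mem_higher {f : MvPowerSeries ℕ ℚ} {a : ℚ} {lam μ : Multiset ℕ}
    (hf : HasLead f a μ) (hμ : ∀ i ∈ μ, 0 < i) (hs : μ.sum = lam.sum) (h : MultLT lam μ) :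
    f ∈ higher lam := by
  have h1 : higher μ ≤ higher lam := by
    refine Submodule.span_mono ?_
    rintro _ ⟨ν, h1, h2, h3, rfl⟩
    exact ⟨ν, h1, h2.trans hs, h.trans h3, rfl⟩
  have h2 := (higher lam).add_mem (h1 hf) ((higher lam).smul_mem a (starProd_mem_higher hμ hs h))
  simpa using h2

theorem hasLead_zero_iff {f : MvPowerSeries ℕ ℚ} {lam : Multiset ℕ} :
    HasLead f 0 lam ↔ f ∈ higher lam := by simp [HasLead]

theorem mul_mem_higher_of_left {f : MvPowerSeries ℕ ℚ} {lam μ : Multiset ℕ} (hf : f ∈ higher lam)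
    (hμ : ∀ i ∈ μ, 0 < i) : f * starProd μ ∈ higher (lam + μ) := by
  induction hf using Submodule.span_induction with
  | mem f hf =>
    obtain ⟨ν, h1, h2, h3, rfl⟩ := hf
    rw [← starProd_add]
    refine starProd_mem_higher (fun i hi => ?_) (by simp [h2]) (h3.add_right μ)
    rcases Multiset.mem_add.mp hi with h | h
    exacts [h1 i h, hμ i h]
  | zero => simp
  | add f g _ _ hf hg => rw [add_mul]; exact Submodule.add_mem _ hf hg
  | smul a f _ hf => rw [smul_mul_assoc]; exact Submodule.smul_mem _ a hf

theorem mul_mem_higher {f g : MvPowerSeries ℕ ℚ} {lam μ : Multiset ℕ} (hf : f ∈ higher lam)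
    (hg : g ∈ higher μ) : f * g ∈ higher (lam + μ) := by
  induction hg using Submodule.span_induction with
  | mem g hg =>
    obtain ⟨ν, h1, h2, h3, rfl⟩ := hg
    have hle : higher (lam + ν) ≤ higher (lam + μ) := by
      refine Submodule.span_mono ?_
      rintro _ ⟨ρ, k1, k2, k3, rfl⟩
      exact ⟨ρ, k1, by rw [k2]; simp [h2], (h3.add_left lam).trans k3, rfl⟩
    exact hle (mul_mem_higher_of_left hf h1)
  | zero => simp
  | add f g _ _ hf hg => rw [mul_add]; exact Submodule.add_mem _ hf hg
  | smul a f _ hf => rw [mul_smul_comm]; exact Submodule.smul_mem _ a hf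

/-- With f = a st_λ + f' and g = b st_μ + g', the three products other than the leading one are
higher, since adding common parts preserves `MultLT`. -/
theorem HasLead.mul {f g : MvPowerSeries ℕ ℚ} {a b : ℚ} {lam μ : Multiset ℕ}
    (hf : HasLead f a lam) (hg : HasLead g b μ) (hlam : ∀ i ∈ lam, 0 < i) (hμ : ∀ i ∈ μ, 0 < i) :
    HasLead (f * g) (a * b) (lam + μ) := by
  have h1 := mul_mem_higher hf hg
  have h2 := (higher (lam + μ)).smul_mem b (mul_mem_higher_of_left hf hμ)
  have h3 := (higher (μ + lam)).smul_mem a (mul_mem_higher_of_left hg hlam)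
  rw [add_comm μ lam] at h3
  have h4 := Submodule.add_mem _ (Submodule.add_mem _ h1 h2) h3
  rw [HasLead, starProd_add]
  convert h4 using 1
  simp only [MvPowerSeries.smul_eq_C_mul, map_mul]
  ring

theorem HasLead.prod {ι : Type*} (s : Finset ι) {f : ι → MvPowerSeries ℕ ℚ} {a : ι → ℚ}
    {lam : ι → Multiset ℕ} (h : ∀ i ∈ s, HasLead (f i) (a i) (lam i))
    (hpos : ∀ i ∈ s, ∀ j ∈ lam i, 0 < j) :
    HasLead (∏ i ∈ s, f i) (∏ i ∈ s, a i) (∑ i ∈ s, lam i) := by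
  induction s using Finset.induction_on with
  | empty => simpa using hasLead_one
  | insert i s hi ih =>
    rw [prod_insert hi, prod_insert hi, sum_insert hi]
    refine (h i (mem_insert_self i s)).mul (ih (fun j hj => h j (mem_insert_of_mem hj))
      fun j hj => hpos j (mem_insert_of_mem hj)) (hpos i (mem_insert_self i s)) ?_
    intro j hj
    obtain ⟨t, ht, hjt⟩ := Multiset.mem_sum.mp hj
    exact hpos t (mem_insert_of_mem ht) j hjt

/-! ### Linear independence of the star products -/

/-- The span of the `st_μ`, `μ ⊢ n`. -/
noncomputable def starSpan (n : ℕ) : Submodule ℚ (MvPowerSeries ℕ ℚ) :=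
  Submodule.span ℚ {f | ∃ μ : Multiset ℕ, (∀ i ∈ μ, 0 < i) ∧ μ.sum = n ∧ f = starProd μ}

theorem mul_mem_starSpan {f g : MvPowerSeries ℕ ℚ} {m n : ℕ} (hf : f ∈ starSpan m)
    (hg : g ∈ starSpan n) : f * g ∈ starSpan (m + n) := by
  have h := Submodule.mul_mem_mul hf hg
  rw [starSpan, starSpan, Submodule.span_mul_span] at h
  refine Submodule.span_mono ?_ h
  rintro _ ⟨_, ⟨μ, h1, h2, rfl⟩, _, ⟨ν, h3, h4, rfl⟩, rfl⟩
  refine ⟨μ + ν, fun i hi => ?_, by simp [h2, h4], (starProd_add μ ν).symm⟩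
  rcases Multiset.mem_add.mp hi with h | h
  exacts [h1 i h, h3 i h]

theorem starSpan_le (n : ℕ) :
    starSpan n ≤ Submodule.span ℚ (Set.range fun lam : n.Partition => starBasis lam) := by
  refine Submodule.span_mono ?_
  rintro _ ⟨μ, h1, h2, rfl⟩
  exact ⟨⟨μ, fun {i} => h1 i, h2⟩, rfl⟩

theorem starBlock_term_eq (k l j : ℕ) :
    starSym 1 ^ (k - 1 - j) * starSym (1 + l + j) =
      starProd (Multiset.replicate (k - 1 - j) 1 + {1 + l + j}) := by
  simp [starProd]

theorem starBlock_mem_starSpan {k : ℕ} (l : ℕ) : starBlock k l ∈ starSpan (k + l) := by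
  refine Submodule.sum_mem _ fun j hj => Submodule.smul_mem _ _ ?_
  rw [starBlock_term_eq]
  refine Submodule.subset_span ⟨_, ?_, ?_, rfl⟩
  · intro i hi
    rcases Multiset.mem_add.mp hi with h | h
    · rw [Multiset.eq_of_mem_replicate h]; exact one_pos
    · rw [Multiset.mem_singleton.mp h]; omega
  · have := mem_range.mp hj
    simp
    omega

/-- The power sum symmetric functions `p_μ`, written in stars. -/
noncomputable def powerSumProd (μ : Multiset ℕ) : MvPowerSeries ℕ ℚ :=
  (μ.map fun k => starBlock k 0).prod

theorem powerSumProd_mem_starSpan (μ : Multiset ℕ) : powerSumProd μ ∈ starSpan μ.sum := by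
  induction μ using Multiset.induction_on with
  | empty =>
    refine Submodule.subset_span ⟨0, by simp, by simp, ?_⟩
    simp [powerSumProd, starProd]
  | cons a μ ih =>
    rw [powerSumProd, Multiset.map_cons, Multiset.prod_cons, Multiset.sum_cons]
    exact mul_mem_starSpan (starBlock_mem_starSpan (k := a) 0) ih

theorem restrictVars_powerSumProd (s : Finset ℕ) {m : ℕ} (a : Fin m → ℕ) (ha : ∀ i, 0 < a i) :
    restrictVars s (powerSumProd (univ.val.map a)) =
      ∑ γ ∈ Fintype.piFinset fun _ : Fin m => s,
        MvPowerSeries.monomial (∑ i, Finsupp.single (γ i) (a i)) 1 := by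
  rw [powerSumProd, Multiset.map_map]
  change restrictVars s (∏ i, starBlock (a i) 0) = _
  rw [map_prod]
  have : ∀ i, restrictVars s (starBlock (a i) 0) = ∑ c ∈ s, MvPowerSeries.X c ^ a i := by
    intro i
    obtain ⟨k, hk⟩ := Nat.exists_eq_succ_of_ne_zero (ha i).ne'
    rw [hk, Nat.succ_eq_add_one, restrictVars_starBlock]
    simp [blockSum]
  rw [prod_congr rfl fun i _ => this i, prod_univ_sum]
  refine sum_congr rfl fun γ _ => ?_
  simp only [MvPowerSeries.X_pow_eq]
  rw [MvPowerSeries.prod_monomial]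
  simp

theorem coeff_powerSumProd {m : ℕ} (a : Fin m → ℕ) (ha : ∀ i, 0 < a i) (d : ℕ →₀ ℕ) :
    MvPowerSeries.coeff d (powerSumProd (univ.val.map a)) =
      (((Fintype.piFinset fun _ : Fin m => d.support).filter
        fun γ => d = ∑ i, Finsupp.single (γ i) (a i)).card : ℚ) := by
  have h := congrArg (MvPowerSeries.coeff d) (restrictVars_powerSumProd d.support a ha)
  rw [coeff_restrictVars, if_pos (Subset.refl _), map_sum] at h
  rw [h]
  simp only [MvPowerSeries.coeff_monomial, sum_boole]

/-- Merging parts only reduces the number of variables. If `m` variables survive then `γ` is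
injective, and the exponents are the parts themselves. -/
theorem eq_of_sum_single {m : ℕ} (a : Fin m → ℕ) (γ : Fin m → ℕ) (ha : ∀ i, 0 < a i) (d : ℕ →₀ ℕ)
    (h : d = ∑ i, Finsupp.single (γ i) (a i)) : d.support.card ≤ m ∧
      (d.support.card = m → d.support.val.map d = univ.val.map a) := by
  have happ : ∀ c, d c = ∑ i, if γ i = c then a i else 0 := by
    intro c; rw [h, Finsupp.finsetSum_apply]; simp [Finsupp.single_apply]
  have hsub : d.support = univ.image γ := by
    ext c
    rw [Finsupp.mem_support_iff, happ, mem_image]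
    constructor
    · intro hc
      obtain ⟨i, hi, hi'⟩ := exists_ne_zero_of_sum_ne_zero hc
      exact ⟨i, hi, by by_contra hne; simp [hne] at hi'⟩
    · rintro ⟨i, -, rfl⟩
      refine (lt_of_lt_of_le (ha i) ?_).ne'
      have := single_le_sum (f := fun j => if γ j = γ i then a j else 0) (fun _ _ => Nat.zero_le _)
        (mem_univ i)
      simpa using this
  rw [hsub]
  refine ⟨card_image_le.trans (by simp), fun hc => ?_⟩
  have hinj : Function.Injective γ := by
    have : (univ.image γ).card = (univ : Finset (Fin m)).card := by rw [hc]; simp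
    have := card_image_iff.mp this
    rwa [coe_univ, Set.injOn_univ] at this
  rw [image_val_of_injOn hinj.injOn, Multiset.map_map]
  refine Multiset.map_congr rfl fun i _ => ?_
  rw [Function.comp_apply, happ]
  simp [hinj.eq_iff]

theorem exists_fin_map (μ : Multiset ℕ) :
    ∃ a : Fin (Multiset.card μ) → ℕ, (univ.val.map a : Multiset ℕ) = μ := by
  induction μ using Quotient.inductionOn with
  | h l =>
    refine ⟨fun i => l.get i, ?_⟩
    change (univ.val.map l.get : Multiset ℕ) = (l : Multiset ℕ)
    rw [Fin.univ_val_map, List.ofFn_get]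

/-- In a vanishing combination take a partition of maximal length with nonzero coefficient. A
monomial in as many variables, with its parts as exponents, occurs in no other product of the
combination. -/
theorem linearIndependent_powerSumProd (n : ℕ) :
    LinearIndependent ℚ fun lam : n.Partition => powerSumProd lam.parts := by
  rw [Fintype.linearIndependent_iff]
  intro g hg
  by_contra! hne
  obtain ⟨i0, hi0⟩ := hne
  obtain ⟨lam, hlam, hmax⟩ := exists_max_image (univ.filter fun lam : n.Partition => g lam ≠ 0)
    (fun lam => Multiset.card lam.parts) ⟨i0, by simpa using hi0⟩
  obtain ⟨a, ha⟩ := exists_fin_map lam.parts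
  have hapos : ∀ i, 0 < a i := fun i => lam.parts_pos (by
    rw [← ha]; exact Multiset.mem_map_of_mem a (mem_univ i))
  -- The test monomial: the parts of `lam` as exponents of distinct variables.
  let d : ℕ →₀ ℕ := ∑ i : Fin (Multiset.card lam.parts), Finsupp.single (i : ℕ) (a i)
  have hinj : Function.Injective (fun i : Fin (Multiset.card lam.parts) => (i : ℕ)) :=
    Fin.val_injective
  have happ : ∀ i : Fin (Multiset.card lam.parts), d i = a i := by
    intro i
    simp only [d, Finsupp.finsetSum_apply, Finsupp.single_apply, Fin.val_inj]
    simp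
  have hcard : d.support.card = Multiset.card lam.parts := by
    refine le_antisymm (eq_of_sum_single a _ hapos d rfl).1 ?_
    have : (univ.image fun i : Fin (Multiset.card lam.parts) => (i : ℕ)) ⊆ d.support := by
      intro c hc
      obtain ⟨i, -, rfl⟩ := mem_image.mp hc
      rw [Finsupp.mem_support_iff, happ]
      exact (hapos i).ne'
    have h := card_le_card this
    rwa [card_image_of_injective _ hinj, card_univ, Fintype.card_fin] at h
  have hval := (eq_of_sum_single a _ hapos d rfl).2 hcard
  have h0 := congrArg (MvPowerSeries.coeff d) hg
  rw [map_sum, map_zero, sum_eq_single lam] at h0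
  · rw [MvPowerSeries.coeff_smul] at h0
    rcases mul_eq_zero.mp h0 with h | h
    · exact (mem_filter.mp hlam).2 h
    · rw [← ha, coeff_powerSumProd a hapos, Nat.cast_eq_zero, card_eq_zero] at h
      have : (fun i : Fin (Multiset.card lam.parts) => (i : ℕ)) ∈
          ((Fintype.piFinset fun _ : Fin (Multiset.card lam.parts) => d.support).filter
        fun γ => d = ∑ i, Finsupp.single (γ i) (a i)) := by
        refine mem_filter.mpr ⟨Fintype.mem_piFinset.mpr fun i => ?_, rfl⟩
        rw [Finsupp.mem_support_iff, happ]
        exact (hapos i).ne'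
      rw [h] at this
      exact absurd this (notMem_empty _)
  · intro μ _ hμ
    rw [MvPowerSeries.coeff_smul]
    by_cases hgμ : g μ = 0
    · simp [hgμ]
    · have hle := hmax μ (mem_filter.mpr ⟨mem_univ _, hgμ⟩)
      obtain ⟨b, hb⟩ := exists_fin_map μ.parts
      have hbpos : ∀ i, 0 < b i := fun i => μ.parts_pos (by
        rw [← hb]; exact Multiset.mem_map_of_mem b (mem_univ i))
      rw [← hb, coeff_powerSumProd b hbpos, filter_false_of_mem]
      · simp
      · intro γ _ hγ
        have h1 := eq_of_sum_single b γ hbpos d hγ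
        apply hμ
        have h2 := h1.2 (le_antisymm h1.1 (by rw [hcard]; exact hle))
        rw [hval, ha, hb] at h2
        exact Nat.Partition.ext h2.symm
  · exact fun h => absurd (mem_univ _) h

/-- A power sum is a block without leaves, so the star products span the power sum products of the
same degree. Both families are indexed by the partitions of `n`, so a dimension count gives
independence. -/
theorem linearIndependent_starBasis (n : ℕ) :
    LinearIndependent ℚ fun lam : n.Partition => starBasis lam := by
  rw [linearIndependent_iff_card_le_finrank_span]
  have h := linearIndependent_iff_card_le_finrank_span.mp (linearIndependent_powerSumProd n)
  refine h.trans ?_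
  have : FiniteDimensional ℚ
      (Submodule.span ℚ (Set.range fun lam : n.Partition => starBasis lam)) :=
    FiniteDimensional.span_of_finite ℚ (Set.finite_range _)
  refine Submodule.finrank_mono (Submodule.span_le.mpr ?_)
  rintro _ ⟨lam, rfl⟩
  have h2 := powerSumProd_mem_starSpan lam.parts
  rw [lam.parts_sum] at h2
  exact starSpan_le n h2

theorem HasLead.isLeadingPartition {n : ℕ} {f : MvPowerSeries ℕ ℚ} {a : ℚ} {lam : n.Partition}
    (h : HasLead f a lam.parts) (ha : a ≠ 0) : IsLeadingPartition f lam := by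
  have key : ∀ g ∈ higher lam.parts, ∃ c : n.Partition → ℚ, g = ∑ μ, c μ • starBasis μ ∧
      ∀ μ, c μ ≠ 0 → MultLT lam.parts μ.parts := by
    intro g hg
    induction hg using Submodule.span_induction with
    | mem g hg =>
      obtain ⟨μ, h1, h2, h3, rfl⟩ := hg
      let ν : n.Partition := ⟨μ, fun {i} => h1 i, h2.trans lam.parts_sum⟩
      refine ⟨Pi.single ν 1, ?_, fun ρ hρ => ?_⟩
      · simp [Pi.single_apply, starBasis, starProd, ν]
      · have : ρ = ν := by by_contra hne; simp [hne] at hρ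
        rw [this]; exact h3
    | zero => exact ⟨0, by simp, by simp⟩
    | add f g _ _ hf hg =>
      obtain ⟨c, rfl, h2⟩ := hf
      obtain ⟨c', rfl, h2'⟩ := hg
      refine ⟨c + c', by simp [add_smul, sum_add_distrib], fun μ hμ => ?_⟩
      by_cases h : c μ = 0
      · exact h2' μ fun h' => hμ (by simp [h, h'])
      · exact h2 μ h
    | smul a f _ hf =>
      obtain ⟨c, rfl, h2⟩ := hf
      refine ⟨a • c, by simp [smul_sum, smul_smul], fun μ hμ => h2 μ fun h => hμ (by simp [h])⟩
  obtain ⟨c, hc, hc'⟩ := key _ h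
  have hirr : ¬ MultLT lam.parts lam.parts := fun ⟨k, h1, _⟩ => lt_irrefl _ h1
  have hlam : c lam = 0 := by by_contra h; exact hirr (hc' _ h)
  refine ⟨c + Pi.single lam a, ?_, ?_, ?_, ?_⟩
  · rw [IsStarExpansion]
    rw [sub_eq_iff_eq_add] at hc
    rw [hc]
    simp [add_smul, sum_add_distrib, Pi.single_apply, starBasis, starProd]
  · intro c' hexp
    rw [IsStarExpansion] at hexp
    rw [sub_eq_iff_eq_add] at hc
    have h2 : ∑ μ, (c' μ - (c μ + (Pi.single lam a : n.Partition → ℚ) μ)) • starBasis μ = 0 := by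
      simp only [sub_smul, sum_sub_distrib, ← hexp, add_smul, sum_add_distrib]
      rw [hc]
      simp [Pi.single_apply, starBasis, starProd]
    have := Fintype.linearIndependent_iff.mp (linearIndependent_starBasis n) _ h2
    funext μ
    exact sub_eq_zero.mp (this μ)
  · simpa [hlam] using ha
  · intro μ hμ
    by_cases h : μ = lam
    · exact Or.inl h.symm
    · exact (hc' μ (by simpa [h] using hμ)).lexLE

end StarLeading

/-! ### The leading coefficient as a count of separating edge sets -/

namespace StarLeading
open Finset
open scoped Classical

theorem hasLead_starProd (μ : Multiset ℕ) : HasLead (starProd μ) 1 μ := by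
  simp [HasLead]

/-- The `j`-th star term has largest part 1 + l + j. This exceeds every 1 + f v unless j = 0 and one
centre carries all the leaves, in which case the two multisets coincide. -/
theorem hasLead_starBlock {V : Type*} (T : Finset V) (hT : T.Nonempty) (f : V → ℕ) :
    HasLead (starBlock T.card (∑ v ∈ T, f v))
      (if ∀ u ∈ T, ∀ u' ∈ T, 0 < f u → 0 < f u' → u = u' then 1 else 0)
      (∑ v ∈ T, {1 + f v}) := by
  set good := ∀ u ∈ T, ∀ u' ∈ T, 0 < f u → 0 < f u' → u = u'
  set l := ∑ v ∈ T, f v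
  have hk : 0 < T.card := hT.card_pos
  have hmem : ∀ i ∈ (∑ v ∈ T, {1 + f v} : Multiset ℕ), ∃ v ∈ T, i = 1 + f v := by
    intro i hi
    obtain ⟨v, hv, hi⟩ := Multiset.mem_sum.mp hi
    exact ⟨v, hv, Multiset.mem_singleton.mp hi⟩
  have hsum : (∑ v ∈ T, {1 + f v} : Multiset ℕ).sum = T.card + l := by
    rw [Multiset.sum_sum]; simp [sum_add_distrib, l]
  have hterm : ∀ j ∈ range T.card,
      HasLead (starProd (Multiset.replicate (T.card - 1 - j) 1 + {1 + l + j}))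
        (if j = 0 ∧ good then 1 else 0) (∑ v ∈ T, {1 + f v}) := by
    intro j hj
    have hj' := mem_range.mp hj
    by_cases hjg : j = 0 ∧ good
    · obtain ⟨rfl, hg⟩ := hjg
      rw [if_pos ⟨rfl, hg⟩]
      have : ∃ v0 ∈ T, ∀ v ∈ T, v ≠ v0 → f v = 0 := by
        by_cases hex : ∃ v0 ∈ T, 0 < f v0
        · obtain ⟨v0, hv0, hp⟩ := hex
          refine ⟨v0, hv0, fun v hv hne => ?_⟩
          by_contra h
          exact hne (hg v hv v0 hv0 (Nat.pos_of_ne_zero h) hp)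
        · push Not at hex
          obtain ⟨v0, hv0⟩ := hT
          exact ⟨v0, hv0, fun v hv _ => Nat.le_zero.mp (hex v hv)⟩
      obtain ⟨v0, hv0, h0⟩ := this
      have e1 : l = f v0 := sum_eq_single v0 (fun v hv hne => h0 v hv hne) (fun h => absurd hv0 h)
      have e2 : (∑ v ∈ T, {1 + f v} : Multiset ℕ) =
          Multiset.replicate (T.card - 1 - 0) 1 + {1 + l + 0} := by
        rw [← sum_erase_add _ _ hv0, e1]
        congr 1
        rw [sum_congr rfl (g := fun _ => ({1} : Multiset ℕ)), sum_const, card_erase_of_mem hv0,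
          Multiset.nsmul_singleton, Nat.sub_zero]
        intro v hv
        rw [h0 v (mem_of_mem_erase hv) (ne_of_mem_erase hv)]
      rw [e2]
      exact hasLead_starProd _
    · rw [if_neg hjg]
      refine hasLead_zero_iff.mpr (starProd_mem_higher ?_ ?_ ?_)
      · intro i hi
        rcases Multiset.mem_add.mp hi with h | h
        · rw [Multiset.eq_of_mem_replicate h]; exact one_pos
        · rw [Multiset.mem_singleton.mp h]; omega
      · rw [hsum]; simp; omega
      · refine multLT_of_forall_lt (k := 1 + l + j) ?_ (by simp) ?_
        · intro i hi
          obtain ⟨v, hv, rfl⟩ := hmem i hi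
          have hle : f v ≤ l := single_le_sum (f := f) (fun _ _ => Nat.zero_le _) hv
          by_cases hj0 : j = 0
          · have hng : ¬ good := fun h => hjg ⟨hj0, h⟩
            simp only [good] at hng
            push Not at hng
            obtain ⟨u, hu, u', hu', hp, hp', hne⟩ := hng
            -- A centre other than `v` that also carries leaves; it forces f v < l.
            obtain ⟨w, hw, hwv, hwp⟩ : ∃ w ∈ T, w ≠ v ∧ 0 < f w := by
              by_cases huv : u = v
              · exact ⟨u', hu', fun h => hne (huv.trans h.symm), hp'⟩
              · exact ⟨u, hu, huv, hp⟩
            have : f w + f v ≤ l := by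
              rw [← sum_pair hwv]
              exact sum_le_sum_of_subset (by
                intro x hx
                rcases mem_insert.mp hx with rfl | hx
                · exact hw
                · rw [mem_singleton.mp hx]; exact hv)
            omega
          · omega
        · intro i hi
          rcases Multiset.mem_add.mp hi with h | h
          · rw [Multiset.eq_of_mem_replicate h]; omega
          · rw [Multiset.mem_singleton.mp h]
  have h := HasLead.sum (range T.card) (fun j hj => (hterm j hj).smul
    ((-1 : ℚ) ^ j * ((T.card - 1).choose j : ℚ)))
  simp only [← starBlock_term_eq] at h
  have e : ∑ i ∈ range T.card, (-1 : ℚ) ^ i * ((T.card - 1).choose i : ℚ) *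
      (if i = 0 ∧ good then 1 else 0) = if good then 1 else 0 := by
    rw [sum_eq_single 0]
    · simp
    · intro j _ hj; simp [hj]
    · intro h0; exact absurd (mem_range.mpr hk) h0
  rw [e] at h
  exact h

variable {V : Type*}

/-- The edges in `B` connect no two different vertices of `U`. -/
def Separates (B : Finset (Sym2 V)) (U : Set V) : Prop :=
  ∀ u ∈ U, ∀ u' ∈ U, (SimpleGraph.fromEdgeSet (B : Set (Sym2 V))).Reachable u u' → u = u'

/-- The number of leaves assigned to `v`. -/
noncomputable def leafCount [Fintype V] (ctr : V → V) (v : V) : ℕ := {u | ctr u ≠ u ∧ ctr u = v}.ncard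

/-- The orders of the stars of the star forest in which `v` hangs from `ctr v`. -/
noncomputable def starParts [Fintype V] (ctr : V → V) : Multiset ℕ :=
  ∑ v with ctr v = v, {1 + leafCount ctr v}

/-- The centres of the stars with at least one leaf. -/
def marked (ctr : V → V) : Set V := {v | ctr v = v ∧ ∃ u, u ≠ v ∧ ctr u = v}

theorem leafCount_pos [Fintype V] {ctr : V → V} {v : V} (hv : ctr v = v) :
    0 < leafCount ctr v ↔ v ∈ marked ctr := by
  rw [leafCount, Set.ncard_pos (Set.toFinite _)]
  constructor
  · rintro ⟨u, h1, h2⟩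
    exact ⟨hv, u, fun h => h1 (by rw [h, hv]), h2⟩
  · rintro ⟨_, u, h1, h2⟩
    exact ⟨u, fun h => h1 (h.symm.trans h2), h2⟩

theorem starParts_pos [Fintype V] (ctr : V → V) : ∀ i ∈ starParts ctr, 0 < i := by
  intro i hi
  obtain ⟨v, _, hv⟩ := Multiset.mem_sum.mp hi
  rw [Multiset.mem_singleton.mp hv]; omega

theorem eq_of_mono_of_reachable {κ : V → ℕ} {B : Finset (Sym2 V)} (h : ∀ e ∈ B, Mono κ e) {a b : V}
    (hab : (SimpleGraph.fromEdgeSet (B : Set (Sym2 V))).Reachable a b) : κ a = κ b := by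
  obtain ⟨p⟩ := hab
  induction p with
  | nil => rfl
  | cons hadj _ ih =>
    rw [SimpleGraph.fromEdgeSet_adj] at hadj
    exact ((mono_mk κ _ _).mp (h _ hadj.1)).trans ih

/-- The blocks are the classes of vertices whose centres are connected by `B`. A block contributes 1
exactly when it has at most one marked centre, and the product over blocks tests separation. -/
theorem hasLead_gen_mono [Fintype V] {ctr : V → V} (hctr : ∀ v, ctr (ctr v) = ctr v)
    (B : Finset (Sym2 V)) (hB : ∀ e ∈ B, ∀ v ∈ e, ctr v = v) :
    HasLead (gen fun κ : V → ℕ => (∀ v, ctr v ≠ v → κ v ≠ κ (ctr v)) ∧ ∀ e ∈ B, Mono κ e)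
      (if Separates B (marked ctr) then 1 else 0) (starParts ctr) := by
  set H := SimpleGraph.fromEdgeSet (B : Set (Sym2 V)) with hH
  let r : Setoid V := Setoid.comap ctr H.reachableSetoid
  have hr : ∀ a b : V, (Quotient.mk r a = Quotient.mk r b) ↔ H.Reachable (ctr a) (ctr b) :=
    fun a b => Quotient.eq
  have hgen : gen (fun κ : V → ℕ => (∀ v, ctr v ≠ v → κ v ≠ κ (ctr v)) ∧ ∀ e ∈ B, Mono κ e) =
      gen fun κ : V → ℕ => ∃ γ : Quotient r → ℕ, (∀ v, ¬ ctr v ≠ v → κ v = γ (Quotient.mk r v)) ∧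
        ∀ v, ctr v ≠ v → κ v ≠ γ (Quotient.mk r v) := by
    refine gen_congr fun κ => ⟨?_, ?_⟩
    · rintro ⟨h1, h2⟩
      have hout : ∀ v, κ (ctr (Quotient.mk r v).out) = κ (ctr v) := fun v =>
        eq_of_mono_of_reachable h2 ((hr _ _).mp (Quotient.out_eq _))
      refine ⟨fun t => κ (ctr t.out), fun v hv => ?_, fun v hv => ?_⟩
      · exact (congrArg κ (not_not.mp hv)).symm.trans (hout v).symm
      · exact fun h => h1 v hv (h.trans (hout v))
    · rintro ⟨γ, h1, h2⟩
      constructor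
      · intro v hv
        have : Quotient.mk r (ctr v) = Quotient.mk r v := (hr _ _).mpr (by rw [hctr])
        rw [h1 (ctr v) (not_not.mpr (hctr v)), this]
        exact h2 v hv
      · intro e he
        induction e using Sym2.ind with
        | _ a b =>
          have ha := hB _ he a (Sym2.mem_mk_left a b)
          have hb := hB _ he b (Sym2.mem_mk_right a b)
          rw [mono_mk, h1 a (not_not.mpr ha), h1 b (not_not.mpr hb)]
          congr 1
          rw [hr, ha, hb]
          by_cases hab : a = b
          · rw [hab]
          · exact SimpleGraph.Adj.reachable
              ((SimpleGraph.fromEdgeSet_adj _).mpr ⟨he, hab⟩)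
  have hex : ∀ t : Quotient r, ∃ v, ¬ ctr v ≠ v ∧ Quotient.mk r v = t := by
    intro t
    refine ⟨ctr t.out, not_not.mpr (hctr _), ?_⟩
    conv_rhs => rw [← Quotient.out_eq t]
    exact (hr _ _).mpr (by rw [hctr])
  rw [hgen, gen_blocks _ _ hex]
  let T : Quotient r → Finset V := fun t => univ.filter fun v => ctr v = v ∧ Quotient.mk r v = t
  have hT : ∀ t, (T t).Nonempty := fun t => by
    obtain ⟨v, h1, h2⟩ := hex t
    exact ⟨v, mem_filter.mpr ⟨mem_univ _, not_not.mp h1, h2⟩⟩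
  have hcard : ∀ t, {v | ¬ ctr v ≠ v ∧ Quotient.mk r v = t}.ncard = (T t).card := fun t => by
    rw [← Set.ncard_coe_finset]; congr 1; ext v; simp [T]
  -- The leaves of a block are counted by their centres, which lie in the same block.
  have hleaf : ∀ t, {v | ctr v ≠ v ∧ Quotient.mk r v = t}.ncard = ∑ v ∈ T t, leafCount ctr v := by
    intro t
    have : {v | ctr v ≠ v ∧ Quotient.mk r v = t} =
        ((univ.filter fun v => ctr v ≠ v ∧ Quotient.mk r v = t : Finset V) : Set V) := by
      ext v; simp
    rw [this, Set.ncard_coe_finset, card_eq_sum_card_fiberwise (f := ctr) (t := T t)]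
    · refine sum_congr rfl fun v hv => ?_
      rw [leafCount, ← Set.ncard_coe_finset]
      congr 1; ext u
      simp only [T, mem_filter, mem_univ, true_and, coe_filter, Set.mem_ofPred_eq] at hv ⊢
      constructor
      · rintro ⟨⟨h1, h2⟩, h3⟩; exact ⟨h1, h3⟩
      · rintro ⟨h1, h2⟩
        refine ⟨⟨h1, ?_⟩, h2⟩
        rw [← hv.2, hr, h2, hv.1]
    · intro u hu
      simp only [coe_filter, mem_univ, true_and, Set.mem_ofPred_eq, T] at hu ⊢
      refine ⟨hctr u, ?_⟩
      rw [← hu.2, hr, hctr]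
  have h := HasLead.prod univ (fun t _ => hasLead_starBlock (T t) (hT t) (leafCount ctr))
    (by
      intro t _ j hj
      obtain ⟨v, _, hv⟩ := Multiset.mem_sum.mp hj
      rw [Multiset.mem_singleton.mp hv]; omega)
  rw [prod_congr rfl fun t _ => by rw [hcard t, hleaf t]]
  convert h using 1
  · have hS : Separates B (marked ctr) ↔ ∀ t, ∀ u ∈ T t, ∀ u' ∈ T t,
        0 < leafCount ctr u → 0 < leafCount ctr u' → u = u' := ?_
    · by_cases hs : Separates B (marked ctr)
      · rw [if_pos hs]
        exact (prod_eq_one fun t _ => if_pos (hS.mp hs t)).symm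
      · rw [if_neg hs]
        rw [hS, not_forall] at hs
        obtain ⟨t, ht⟩ := hs
        exact (prod_eq_zero (mem_univ t) (if_neg ht)).symm
    constructor
    · intro hs t u hu u' hu' hp hp'
      simp only [T, mem_filter, mem_univ, true_and] at hu hu'
      refine hs u ((leafCount_pos hu.1).mp hp) u' ((leafCount_pos hu'.1).mp hp') ?_
      have := (hr u u').mp (hu.2.trans hu'.2.symm)
      rwa [hu.1, hu'.1] at this
    · intro hg u hu u' hu' hreach
      refine hg (Quotient.mk r u) u ?_ u' ?_ ((leafCount_pos hu.1).mpr hu)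
        ((leafCount_pos hu'.1).mpr hu')
      · simp [T, hu.1]
      · simp only [T, mem_filter, mem_univ, true_and]
        refine ⟨hu'.1, ?_⟩
        rw [hr, hu.1, hu'.1]
        exact hreach.symm
  · rw [starParts, ← sum_fiberwise_of_maps_to (s := univ.filter fun v => ctr v = v) (t := univ)
      (g := Quotient.mk r) (fun _ _ => mem_univ _)]
    refine sum_congr rfl fun t _ => sum_congr ?_ fun _ _ => rfl
    ext v; simp [T]

theorem hasLead_gen [Fintype V] {ctr : V → V} (hctr : ∀ v, ctr (ctr v) = ctr v)
    (F I : Finset (Sym2 V)) (hF : ∀ e ∈ F, ∀ v ∈ e, ctr v = v) (hI : ∀ e ∈ I, ∀ v ∈ e, ctr v = v) :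
    HasLead (gen fun κ : V → ℕ => ((∀ v, ctr v ≠ v → κ v ≠ κ (ctr v)) ∧ ∀ e ∈ F, Mono κ e) ∧
      ∀ e ∈ I, ¬ Mono κ e)
      (∑ A ∈ I.powerset, if Separates (F ∪ A) (marked ctr) then (-1) ^ A.card else 0)
      (starParts ctr) := by
  rw [gen_inclusion_exclusion]
  refine HasLead.sum _ fun A hA => ?_
  have h := (hasLead_gen_mono hctr (F ∪ A) (fun e he => by
    rcases mem_union.mp he with h | h
    exacts [hF e h, hI e (mem_powerset.mp hA h)])).smul ((-1 : ℚ) ^ A.card)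
  rw [mul_ite, mul_one, mul_zero] at h
  convert h using 2
  refine gen_congr fun κ => ?_
  simp only [mem_union, or_imp, forall_and]
  tauto

end StarLeading

/-! ### Signs of the separation sums of forests and cycles -/

namespace StarLeading
open Finset
open scoped Classical

section Separation

variable {V : Type*}

/-- The graph with edge set `E`. -/
abbrev edgeGraph (E : Finset (Sym2 V)) : SimpleGraph V :=
  SimpleGraph.fromEdgeSet (E : Set (Sym2 V))

theorem edgeGraph_mono {A B : Finset (Sym2 V)} (h : A ⊆ B) : edgeGraph A ≤ edgeGraph B :=
  SimpleGraph.fromEdgeSet_mono (by exact_mod_cast h)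

theorem Separates.mono {A B : Finset (Sym2 V)} {U : Set V} (h : Separates B U) (hAB : A ⊆ B) :
    Separates A U :=
  fun u hu u' hu' hr => h u hu u' hu' (hr.mono (edgeGraph_mono hAB))

theorem reachable_map {W : Type*} {G : SimpleGraph V} {H : SimpleGraph W} (f : V → W)
    (hf : ∀ a b, G.Adj a b → H.Reachable (f a) (f b)) {a b : V} (h : G.Reachable a b) :
    H.Reachable (f a) (f b) := by
  obtain ⟨p⟩ := h
  induction p with
  | nil => exact SimpleGraph.Reachable.refl _
  | cons hadj _ ih => exact (hf _ _ hadj).trans ih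

theorem exists_edge_of_reachable_ne {A : Finset (Sym2 V)} {u x : V}
    (h : (edgeGraph A).Reachable u x) (hne : u ≠ x) : ∃ e ∈ A, u ∈ e := by
  obtain ⟨p⟩ := h
  cases p with
  | nil => exact absurd rfl hne
  | cons hadj _ => exact ⟨_, ((SimpleGraph.fromEdgeSet_adj _).mp hadj).1, Sym2.mem_mk_left _ _⟩

theorem eq_of_reachable_of_isolated {A : Finset (Sym2 V)} {u x : V} (hu : ∀ e ∈ A, u ∉ e)
    (h : (edgeGraph A).Reachable u x) : u = x := by
  by_contra hne
  obtain ⟨e, he, hue⟩ := exists_edge_of_reachable_ne h hne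
  exact hu e he hue

theorem adj_edgeGraph_insert {A : Finset (Sym2 V)} {u y : V} (h : u ≠ y) :
    (edgeGraph (insert s(u, y) A)).Adj u y :=
  (SimpleGraph.fromEdgeSet_adj _).mpr ⟨by simp, h⟩

theorem reachable_insert {A : Finset (Sym2 V)} {u y a b : V}
    (h : (edgeGraph (insert s(u, y) A)).Reachable a b) : (edgeGraph A).Reachable a b ∨
      ((edgeGraph A).Reachable a u ∧ (edgeGraph A).Reachable y b) ∨
      ((edgeGraph A).Reachable a y ∧ (edgeGraph A).Reachable u b) := by
  obtain ⟨p⟩ := h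
  induction p with
  | nil => exact Or.inl (SimpleGraph.Reachable.refl _)
  | @cons a c b hadj _ ih =>
    rw [SimpleGraph.fromEdgeSet_adj] at hadj
    obtain ⟨he, hne⟩ := hadj
    rcases mem_insert.mp (mem_coe.mp he) with h | h
    · rcases Sym2.eq_iff.mp h with ⟨rfl, rfl⟩ | ⟨rfl, rfl⟩
      · rcases ih with h1 | ⟨_, h2⟩ | ⟨_, h2⟩
        · exact Or.inr (Or.inl ⟨SimpleGraph.Reachable.refl _, h1⟩)
        · exact Or.inr (Or.inl ⟨SimpleGraph.Reachable.refl _, h2⟩)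
        · exact Or.inl h2
      · rcases ih with h1 | ⟨_, h2⟩ | ⟨_, h2⟩
        · exact Or.inr (Or.inr ⟨SimpleGraph.Reachable.refl _, h1⟩)
        · exact Or.inl h2
        · exact Or.inr (Or.inr ⟨SimpleGraph.Reachable.refl _, h2⟩)
    · have hac : (edgeGraph A).Reachable a c :=
        SimpleGraph.Adj.reachable ((SimpleGraph.fromEdgeSet_adj _).mpr ⟨h, hne⟩)
      rcases ih with h1 | ⟨h1, h2⟩ | ⟨h1, h2⟩
      · exact Or.inl (hac.trans h1)
      · exact Or.inr (Or.inl ⟨hac.trans h1, h2⟩)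
      · exact Or.inr (Or.inr ⟨hac.trans h1, h2⟩)

/-- No path between two other vertices uses a pendant edge. -/
theorem separates_insert_pendant {A : Finset (Sym2 V)} {u x : V} {U : Set V} (hu : u ∉ U)
    (hA : ∀ e ∈ A, u ∉ e) : Separates (insert s(u, x) A) U ↔ Separates A U := by
  refine ⟨fun h => h.mono (subset_insert _ _), fun h z hz z' hz' hr => ?_⟩
  rcases reachable_insert hr with h1 | ⟨h1, _⟩ | ⟨_, h2⟩
  · exact h z hz z' hz' h1
  · exact absurd (eq_of_reachable_of_isolated hA h1.symm ▸ hz) hu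
  · exact absurd (eq_of_reachable_of_isolated hA h2 ▸ hz') hu

theorem not_separates_insert {A : Finset (Sym2 V)} {u x : V} {U : Set V} (hu : u ∈ U) (hx : x ∈ U)
    (hne : u ≠ x) : ¬ Separates (insert s(u, x) A) U := fun h =>
  hne (h u hu x hx (adj_edgeGraph_insert hne).reachable)

/-- Joining `y` to `u ∈ U` makes `y` stand for `u`: separation then asks that `A` connect `y` to no
vertex of `U`. -/
theorem separates_insert_iff {A : Finset (Sym2 V)} {u y : V} {U : Set V} (hu : u ∈ U) (hy : y ∉ U)
    (hr : ¬ (edgeGraph A).Reachable u y) :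
    Separates (insert s(u, y) A) U ↔ Separates A (insert y U) := by
  have huy : u ≠ y := fun h => hy (h ▸ hu)
  constructor
  · intro h
    have key : ∀ z ∈ U, ¬ (edgeGraph A).Reachable y z := by
      intro z hz h1
      have h2 := h u hu z hz ((adj_edgeGraph_insert huy).reachable.trans
        (h1.mono (edgeGraph_mono (subset_insert _ _))))
      exact hr (h2 ▸ h1.symm)
    intro z hz z' hz' h1
    rcases hz with rfl | hz <;> rcases hz' with rfl | hz'
    · rfl
    · exact absurd h1 (key z' hz')
    · exact absurd h1.symm (key z hz)
    · exact h.mono (subset_insert _ _) z hz z' hz' h1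
  · intro h z hz z' hz' h1
    rcases reachable_insert h1 with h1 | ⟨_, h2⟩ | ⟨h1, _⟩
    · exact h z (Or.inr hz) z' (Or.inr hz') h1
    · exact absurd (h y (Or.inl rfl) z' (Or.inr hz') h2 ▸ hz') hy
    · exact absurd (h z (Or.inr hz) y (Or.inl rfl) h1 ▸ hz) hy

/-- The signed number of sets of edges in `E` that connect no two vertices of `U`. -/
noncomputable def sepSum (E : Finset (Sym2 V)) (U : Set V) : ℚ :=
  ∑ A ∈ E.powerset, if Separates A U then (-1) ^ A.card else 0

theorem sepSum_insert {E : Finset (Sym2 V)} {e : Sym2 V} (he : e ∉ E) (U : Set V) :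
    sepSum (insert e E) U = sepSum E U -
      ∑ A ∈ E.powerset, if Separates (insert e A) U then (-1) ^ A.card else 0 := by
  rw [sepSum, sum_powerset_insert he, sub_eq_add_neg, ← sum_neg_distrib]
  congr 1
  refine sum_congr rfl fun A hA => ?_
  rw [card_insert_of_notMem fun h => he (mem_powerset.mp hA h)]
  split_ifs <;> ring

/-- The sets with and without the pendant edge cancel in pairs. -/
theorem sepSum_insert_pendant {E : Finset (Sym2 V)} {u x : V} {U : Set V} (he : s(u, x) ∉ E)
    (hE : ∀ e ∈ E, u ∉ e) (hu : u ∉ U) : sepSum (insert s(u, x) E) U = 0 := by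
  rw [sepSum_insert he, sub_eq_zero]
  refine sum_congr rfl fun A hA => ?_
  simp only [separates_insert_pendant hu fun e h => hE e (mem_powerset.mp hA h)]

theorem sepSum_insert_of_mem {E : Finset (Sym2 V)} {u x : V} {U : Set V} (he : s(u, x) ∉ E)
    (hu : u ∈ U) (hx : x ∈ U) (hne : u ≠ x) : sepSum (insert s(u, x) E) U = sepSum E U := by
  rw [sepSum_insert he, sum_eq_zero, sub_zero]
  intro A _
  rw [if_neg (not_separates_insert hu hx hne)]

/-- The sets containing the new edge are governed by `separates_insert_iff`. Those already joining
`u` to `y` escape it, and hypothesis `h` makes them contribute nothing. -/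
theorem sepSum_insert_of_notMem {E : Finset (Sym2 V)} {u y : V} {U : Set V} (he : s(u, y) ∉ E)
    (hu : u ∈ U) (hy : y ∉ U)
    (h : ∀ A ⊆ E, (edgeGraph A).Reachable u y → ¬ Separates A U) :
    sepSum (insert s(u, y) E) U = sepSum E U - sepSum E (insert y U) := by
  rw [sepSum_insert he]
  congr 1
  refine sum_congr rfl fun A hA => ?_
  by_cases hr : (edgeGraph A).Reachable u y
  · rw [if_neg fun hs => h A (mem_powerset.mp hA) hr (hs.mono (subset_insert _ _)), if_neg]
    intro hs
    exact hy (hs u (Or.inr hu) y (Or.inl rfl) hr ▸ hu)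
  · simp only [separates_insert_iff hu hy hr]

/-- The number of edges in `E` at `v`. -/
noncomputable def edgeDeg (E : Finset (Sym2 V)) (v : V) : ℕ := (E.filter (v ∈ ·)).card

theorem edgeDeg_insert {E : Finset (Sym2 V)} {e : Sym2 V} (he : e ∉ E) (v : V) :
    edgeDeg (insert e E) v = edgeDeg E v + if v ∈ e then 1 else 0 := by
  rw [edgeDeg, filter_insert]
  split_ifs with h
  · rw [card_insert_of_notMem fun h => he (mem_filter.mp h).1, edgeDeg]
  · rw [edgeDeg, add_zero]

theorem edgeDeg_eq_zero {E : Finset (Sym2 V)} {v : V} (h : ∀ e ∈ E, v ∉ e) : edgeDeg E v = 0 := by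
  rw [edgeDeg, card_eq_zero, filter_false_of_mem h]

theorem sepSum_eq_zero_of_edgeDeg_eq_one {E : Finset (Sym2 V)} {U : Set V} {x : V}
    (hd : edgeDeg E x = 1) (hx : x ∉ U) : sepSum E U = 0 := by
  obtain ⟨e, he⟩ := card_eq_one.mp hd
  have he' : e ∈ E.filter (x ∈ ·) := by rw [he]; exact mem_singleton_self e
  obtain ⟨heE, hxe⟩ := mem_filter.mp he'
  obtain ⟨y, rfl⟩ := hxe
  rw [← insert_erase heE]
  refine sepSum_insert_pendant (notMem_erase _ _) (fun e h hxe => ?_) hx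
  have : e ∈ E.filter (x ∈ ·) := mem_filter.mpr ⟨mem_of_mem_erase h, hxe⟩
  rw [he, mem_singleton] at this
  exact ne_of_mem_erase h this

/-- The far end of a longest path from `r` is a leaf. -/
theorem exists_leaf [Fintype V] {H : SimpleGraph V} (hH : H.IsAcyclic) {r z : V} (hr : H.Adj r z) :
    ∃ u x, u ≠ r ∧ H.Reachable r u ∧ H.Adj u x ∧ ∀ y, H.Adj u y → y = x := by
  let L : Set ℕ := {n | ∃ (u : V) (p : H.Walk r u), p.IsPath ∧ p.length = n}
  have hL : BddAbove L := ⟨Fintype.card V, by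
    rintro _ ⟨u, p, hp, rfl⟩; exact hp.length_lt.le⟩
  have h1 : 1 ≤ sSup L := le_csSup hL
    ⟨z, SimpleGraph.Walk.cons hr SimpleGraph.Walk.nil, by simp [hr.ne], rfl⟩
  obtain ⟨u, p, hp, hlen⟩ := Nat.sSup_mem (s := L)
    ⟨0, r, SimpleGraph.Walk.nil, by simp, rfl⟩ hL
  have hnil : ¬ p.Nil := by
    rw [← SimpleGraph.Walk.length_eq_zero_iff]; omega
  have key : ∀ y, H.Adj u y → y = p.penultimate := by
    intro y hy
    refine hH.eq_penultimate_of_adj_end hp hy ?_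
    by_contra hsupp
    have := le_csSup hL ⟨y, p.concat hy, hp.concat hsupp hy, rfl⟩
    rw [SimpleGraph.Walk.length_concat] at this
    omega
  refine ⟨u, p.penultimate, ?_, p.reachable, (p.adj_penultimate hnil).symm, key⟩
  rintro rfl
  exact hnil (SimpleGraph.Walk.isPath_iff_nil.mp hp)

/-- A component of `E` contains at most one vertex of `S`. Rooting a nontrivial component there, if
there is one, gives a leaf other than the root. -/
theorem exists_leaf_notMem [Fintype V] {E : Finset (Sym2 V)} (hE : (edgeGraph E).IsAcyclic)
    (hd : ∀ e ∈ E, ¬ e.IsDiag) (hne : E.Nonempty) {S : Set V} (hS : Separates E S) :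
    ∃ u x, u ∉ S ∧ u ≠ x ∧ s(u, x) ∈ E ∧ ∀ e ∈ E.erase s(u, x), u ∉ e := by
  obtain ⟨e, he⟩ := hne
  induction e using Sym2.ind with
  | _ a b =>
    have hab : (edgeGraph E).Adj a b := (SimpleGraph.fromEdgeSet_adj _).mpr ⟨he, by simpa using hd _ he⟩
    obtain ⟨r, z, hrz, hr⟩ : ∃ r z, (edgeGraph E).Adj r z ∧
        ∀ u, (edgeGraph E).Reachable r u → u ∈ S → u = r := by
      by_cases h : ∃ r ∈ S, (edgeGraph E).Reachable a r
      · obtain ⟨r, hrS, hra⟩ := h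
        by_cases har : r = a
        · subst har
          exact ⟨r, b, hab, fun u hu huS => hS u huS r hrS hu.symm⟩
        · obtain ⟨e, he, hre⟩ := exists_edge_of_reachable_ne hra.symm har
          obtain ⟨z, rfl⟩ := hre
          exact ⟨r, z, (SimpleGraph.fromEdgeSet_adj _).mpr ⟨he, by simpa using hd _ he⟩,
            fun u hu huS => hS u huS r hrS hu.symm⟩
      · push Not at h
        exact ⟨a, b, hab, fun u hu huS => absurd hu (h u huS)⟩
    obtain ⟨u, x, hur, hru, hux, huniq⟩ := exists_leaf hE hrz
    refine ⟨u, x, fun h => hur (hr u hru h), hux.ne, ((SimpleGraph.fromEdgeSet_adj _).mp hux).1, ?_⟩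
    rintro e he ⟨y, rfl⟩
    have hmem := mem_of_mem_erase he
    have := huniq y ((SimpleGraph.fromEdgeSet_adj _).mpr ⟨hmem, by simpa using hd _ hmem⟩)
    exact ne_of_mem_erase he (by rw [this])

theorem neg_one_pow_compl_insert [Fintype V] {U : Set V} {x : V} (hx : x ∉ U) :
    (-1 : ℚ) ^ Uᶜ.ncard = - (-1) ^ (insert x U)ᶜ.ncard := by
  have : Uᶜ = insert x (insert x U)ᶜ := by
    ext v
    by_cases h : v = x
    · simp [h, hx]
    · simp [h]
  rw [this, Set.ncard_insert_of_notMem (by simp) (Set.toFinite _), pow_succ]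
  simp

/-- The edges of `E` are removed one by one at leaves `u ∉ S`. The neighbour `x` either lies in `U`,
or splits the sum into two terms; adding `x` to `U` flips both the sign of that term and the parity
of the complement, so the normalised terms add up. A vertex of `S` on an edge of `E` is eventually
such an `x` along the branch that always enlarges `U`, which is why it counts towards the threshold
`t`. The threshold is 0 for forests and 2 for a cycle. -/
theorem sepSum_strip [Fintype V] {CE : Finset (Sym2 V)} {S : Set V} (hCE : ∀ e ∈ CE, ∀ v ∈ e, v ∈ S)
    (t : ℕ)
    (base : ∀ U : Set V, (∀ v ∉ U, 2 ≤ edgeDeg CE v) → 0 ≤ (-1) ^ Uᶜ.ncard * sepSum CE U ∧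
      (t ≤ (U ∩ S).ncard → 0 < (-1) ^ Uᶜ.ncard * sepSum CE U)) :
    ∀ (n : ℕ) (E : Finset (Sym2 V)), E.card = n → Disjoint CE E → (∀ e ∈ E, ¬ e.IsDiag) →
      (edgeGraph E).IsAcyclic → Separates E S → ∀ U : Set V, (∀ v ∉ U, 2 ≤ edgeDeg (CE ∪ E) v) →
      0 ≤ (-1) ^ Uᶜ.ncard * sepSum (CE ∪ E) U ∧
      (t ≤ {v | v ∈ S ∧ (v ∈ U ∨ ∃ e ∈ E, v ∈ e)}.ncard →
        0 < (-1) ^ Uᶜ.ncard * sepSum (CE ∪ E) U) := by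
  intro n
  induction n with
  | zero =>
    intro E hE _ _ _ _ U hU
    rw [card_eq_zero] at hE
    subst hE
    rw [union_empty] at hU ⊢
    convert base U hU using 5
    ext v; simp [and_comm]
  | succ n ih =>
    intro E hE hdisj hdiag hac hsep U hU
    obtain ⟨u, x, huS, hux, hmem, hiso⟩ := exists_leaf_notMem hac hdiag
      (card_pos.mp (by omega)) hsep
    set E' := E.erase s(u, x) with hE'
    have hsub : E' ⊆ E := erase_subset _ _
    have hn : s(u, x) ∉ CE ∪ E' := by
      rw [mem_union, not_or]
      exact ⟨fun h => disjoint_left.mp hdisj h hmem, notMem_erase _ _⟩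
    have hins : CE ∪ E = insert s(u, x) (CE ∪ E') := by
      rw [← union_insert, hE', insert_erase hmem]
    have hisoall : ∀ e ∈ CE ∪ E', u ∉ e := by
      intro e he hue
      rcases mem_union.mp he with h | h
      · exact huS (hCE e h u hue)
      · exact hiso e h hue
    -- A vertex of degree 1 cannot lie outside `U`.
    have huU : u ∈ U := by
      by_contra h
      have := hU u h
      rw [hins, edgeDeg_insert hn, edgeDeg_eq_zero hisoall] at this
      split_ifs at this <;> omega
    have ih' := ih E' (by rw [hE', card_erase_of_mem hmem, hE]; rfl)
      (disjoint_of_subset_right hsub hdisj) (fun e he => hdiag e (hsub he))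
      (hac.anti (edgeGraph_mono hsub)) (hsep.mono hsub)
    have hdeg : ∀ v, v ≠ u → v ≠ x → edgeDeg (CE ∪ E') v = edgeDeg (CE ∪ E) v := by
      intro v h1 h2
      rw [hins, edgeDeg_insert hn, if_neg (by simp [h1, h2]), add_zero]
    have hset : ∀ U' : Set V, U ⊆ U' → x ∈ U' → {v | v ∈ S ∧ (v ∈ U ∨ ∃ e ∈ E, v ∈ e)}.ncard ≤
        {v | v ∈ S ∧ (v ∈ U' ∨ ∃ e ∈ E', v ∈ e)}.ncard := by
      intro U' hUU' hx
      refine Set.ncard_le_ncard ?_ (Set.toFinite _)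
      rintro v ⟨hvS, hv | ⟨e, he, hve⟩⟩
      · exact ⟨hvS, Or.inl (hUU' hv)⟩
      · refine ⟨hvS, ?_⟩
        by_cases hes : e = s(u, x)
        · rw [hes] at hve
          rcases Sym2.mem_iff.mp hve with rfl | rfl
          · exact absurd hvS huS
          · exact Or.inl hx
        · exact Or.inr ⟨e, mem_erase.mpr ⟨hes, he⟩, hve⟩
    rw [hins] at hU ⊢
    by_cases hxU : x ∈ U
    · rw [sepSum_insert_of_mem hn huU hxU hux]
      have h := ih' U fun v hv => by
        rw [hdeg v (fun h => hv (h ▸ huU)) (fun h => hv (h ▸ hxU)), hins]; exact hU v hv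
      exact ⟨h.1, fun ht => h.2 (ht.trans (hset U subset_rfl hxU))⟩
    · rw [sepSum_insert_of_notMem hn huU hxU]
      · have h2 := ih' (insert x U) fun v hv => by
          rw [Set.mem_insert_iff, not_or] at hv
          rw [hdeg v (fun h => hv.2 (h ▸ huU)) hv.1, hins]; exact hU v hv.2
        -- Losing the edge may leave `x` with degree 1 outside `U`; the degree hypothesis then
        -- fails, but the sum is zero.
        have h1 : 0 ≤ (-1) ^ Uᶜ.ncard * sepSum (CE ∪ E') U := by
          by_cases hdx : 2 ≤ edgeDeg (CE ∪ E') x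
          · refine (ih' U fun v hv => ?_).1
            by_cases hvx : v = x
            · rw [hvx]; exact hdx
            · rw [hdeg v (fun h => hv (h ▸ huU)) hvx, hins]; exact hU v hv
          · have := hU x hxU
            rw [edgeDeg_insert hn, if_pos (by simp)] at this
            rw [sepSum_eq_zero_of_edgeDeg_eq_one (by omega) hxU, mul_zero]
        rw [mul_sub]
        have e : (-1) ^ Uᶜ.ncard * sepSum (CE ∪ E') (insert x U) =
            - ((-1) ^ (insert x U)ᶜ.ncard * sepSum (CE ∪ E') (insert x U)) := by
          rw [neg_one_pow_compl_insert hxU]; ring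
        rw [e]
        refine ⟨by linarith [h2.1], fun ht => ?_⟩
        have := h2.2 (ht.trans (hset _ (Set.subset_insert _ _) (Set.mem_insert _ _)))
        linarith
      · intro A hA hr
        exact absurd (eq_of_reachable_of_isolated (fun e he => hisoall e (hA he)) hr) hux

/-- The case of an empty core: at the end no edges remain, so the degree condition forces U to be
everything and the sum is 1. -/
theorem sepSum_forest [Fintype V] {E : Finset (Sym2 V)} (hd : ∀ e ∈ E, ¬ e.IsDiag)
    (hac : (edgeGraph E).IsAcyclic) {U : Set V} (hU : ∀ v ∉ U, 2 ≤ edgeDeg E v) :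
    0 < (-1) ^ Uᶜ.ncard * sepSum E U := by
  have h := sepSum_strip (CE := ∅) (S := (∅ : Set V)) (by simp) 0 (by
    intro U hU
    have hUu : Uᶜ = ∅ := by
      ext v
      simp only [Set.mem_compl_iff, Set.mem_empty_iff_false, iff_false, not_not]
      by_contra hv
      have := hU v hv
      rw [edgeDeg_eq_zero (by simp)] at this
      omega
    have hs : Separates ∅ U := fun u _ u' _ hr => eq_of_reachable_of_isolated (by simp) hr
    rw [hUu, sepSum]
    simp [hs]) E.card E rfl (disjoint_empty_left _) hd hac (fun u hu => absurd hu (by simp)) U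
    (by rwa [empty_union])
  rw [empty_union] at h
  exact h.2 (Nat.zero_le _)

/-- With two vertices of `U` on the cycle, expanding along a cycle edge at one of them leaves a
path, to which the forest case applies. -/
theorem sepSum_cycle [Fintype V] {CE : Finset (Sym2 V)} {S : Set V} (hd : ∀ e ∈ CE, ¬ e.IsDiag)
    (hne : CE.Nonempty) (hCE : ∀ e ∈ CE, ∀ v ∈ e, v ∈ S) (hS : ∀ v ∈ S, ∃ e ∈ CE, v ∈ e)
    (hac : ∀ e ∈ CE, (edgeGraph (CE.erase e)).IsAcyclic)
    (hconn : ∀ e ∈ CE, ∀ u ∈ S, ∀ v ∈ S, (edgeGraph (CE.erase e)).Reachable u v)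
    (U : Set V) (hU : ∀ v ∉ U, 2 ≤ edgeDeg CE v) :
    0 ≤ (-1) ^ Uᶜ.ncard * sepSum CE U ∧
      (2 ≤ (U ∩ S).ncard → 0 < (-1) ^ Uᶜ.ncard * sepSum CE U) := by
  by_cases hm : 2 ≤ (U ∩ S).ncard
  · suffices h : 0 < (-1) ^ Uᶜ.ncard * sepSum CE U from ⟨h.le, fun _ => h⟩
    obtain ⟨u, hu, u', hu', huu'⟩ := (Set.one_lt_ncard (Set.toFinite _)).mp hm
    obtain ⟨f, hf, y, rfl⟩ := hS u hu.2
    have huy : u ≠ y := by simpa using hd _ hf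
    set E' := CE.erase s(u, y) with hE'
    have hn : s(u, y) ∉ E' := notMem_erase _ _
    have hins : CE = insert s(u, y) E' := (insert_erase hf).symm
    have hdE' : ∀ e ∈ E', ¬ e.IsDiag := fun e he => hd e (mem_of_mem_erase he)
    have hdeg : ∀ v, v ≠ u → v ≠ y → edgeDeg E' v = edgeDeg CE v := by
      intro v h1 h2
      rw [hins, edgeDeg_insert hn, if_neg (by simp [h1, h2]), add_zero]
    by_cases hyU : y ∈ U
    · rw [hins, sepSum_insert_of_mem hn hu.1 hyU huy]
      refine sepSum_forest hdE' (hac _ hf) fun v hv => ?_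
      rw [hdeg v (fun h => hv (h ▸ hu.1)) (fun h => hv (h ▸ hyU))]
      exact hU v hv
    · rw [hins, sepSum_insert_of_notMem hn hu.1 hyU]
      · have h2 : 0 < (-1) ^ (insert y U)ᶜ.ncard * sepSum E' (insert y U) := by
          refine sepSum_forest hdE' (hac _ hf) fun v hv => ?_
          rw [Set.mem_insert_iff, not_or] at hv
          rw [hdeg v (fun h => hv.2 (h ▸ hu.1)) hv.1]; exact hU v hv.2
        have h1 : 0 ≤ (-1) ^ Uᶜ.ncard * sepSum E' U := by
          by_cases hdy : 2 ≤ edgeDeg E' y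
          · refine (sepSum_forest hdE' (hac _ hf) fun v hv => ?_).le
            by_cases hvy : v = y
            · rw [hvy]; exact hdy
            · rw [hdeg v (fun h => hv (h ▸ hu.1)) hvy]; exact hU v hv
          · have := hU y hyU
            rw [hins, edgeDeg_insert hn, if_pos (by simp)] at this
            rw [sepSum_eq_zero_of_edgeDeg_eq_one (by omega) hyU, mul_zero]
        rw [neg_one_pow_compl_insert hyU] at h1 ⊢
        linarith
      · intro A hA hr
        -- If `A` missed an edge `g`, then `u` and `y` would be joined in the forest `CE.erase g`
        -- without using its edge `s(u, y)`, which is a bridge there.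
        have hAE : A = E' := by
          refine Subset.antisymm hA fun g hg => ?_
          by_contra hgA
          have hgC : g ∈ CE := mem_of_mem_erase hg
          have hadj : (edgeGraph (CE.erase g)).Adj u y :=
            (SimpleGraph.fromEdgeSet_adj _).mpr ⟨by
              exact_mod_cast mem_erase.mpr ⟨(ne_of_mem_erase hg).symm, hf⟩, huy⟩
          have hb := SimpleGraph.isAcyclic_iff_forall_adj_isBridge.mp (hac g hgC) hadj
          rw [SimpleGraph.isBridge_iff] at hb
          refine hb (hr.mono fun a b hab => ?_)
          rw [SimpleGraph.fromEdgeSet_adj] at hab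
          rw [SimpleGraph.deleteEdges_adj, SimpleGraph.fromEdgeSet_adj]
          have h1 := hA hab.1
          refine ⟨⟨?_, hab.2⟩, ?_⟩
          · have : s(a, b) ≠ g := fun h => hgA (h ▸ hab.1)
            exact_mod_cast mem_erase.mpr ⟨this, mem_of_mem_erase h1⟩
          · exact fun h => ne_of_mem_erase h1 h
        intro hs
        rw [hAE] at hs
        exact huu' (hs u hu.1 u' hu'.1 (hconn _ hf u hu.2 u' hu'.2))
  -- With at most one vertex of `U` on the cycle every subset separates, and the full alternating
  -- sum is zero.
  · suffices h : sepSum CE U = 0 by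
      rw [h, mul_zero]; exact ⟨le_rfl, fun h' => absurd h' hm⟩
    rw [sepSum, ← Rat.intCast_zero, ← sum_powerset_neg_one_pow_card_of_nonempty hne, Int.cast_sum]
    refine sum_congr rfl fun A hA => ?_
    rw [if_pos]
    · push_cast; rfl
    · intro u hu u' hu' hr
      by_contra hne
      have hmem : ∀ {a b}, (edgeGraph A).Reachable a b → a ≠ b → a ∈ S := by
        intro a b hr hne
        obtain ⟨e, he, hae⟩ := exists_edge_of_reachable_ne hr hne
        exact hCE e (mem_powerset.mp hA he) a hae
      exact hm ((Set.one_lt_ncard (Set.toFinite _)).mpr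
        ⟨u, ⟨hu, hmem hr hne⟩, u', ⟨hu', hmem hr.symm (Ne.symm hne)⟩, hne⟩)

end Separation

end StarLeading

/-! ### Leaf maps, internal edges and leaf components -/

namespace StarLeading
open Finset
open scoped Classical

section Graph

variable {V : Type*}

/-- The vertex `v` has at least two neighbours. -/
def Branching (G : SimpleGraph V) (v : V) : Prop := ∃ a b, G.Adj v a ∧ G.Adj v b ∧ a ≠ b

theorem two_le_degree_iff [Fintype V] (G : SimpleGraph V) (v : V) :
    2 ≤ G.degree v ↔ Branching G v := by
  rw [← SimpleGraph.card_neighborFinset_eq_degree, ← Nat.lt_iff_add_one_le, one_lt_card]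
  simp only [SimpleGraph.mem_neighborFinset, Branching]
  constructor
  · rintro ⟨a, ha, b, hb, h⟩; exact ⟨a, b, ha, hb, h⟩
  · rintro ⟨a, b, ha, hb, h⟩; exact ⟨a, ha, b, hb, h⟩

theorem mem_internalEdges [Fintype V] {G : SimpleGraph V} {a b : V} :
    s(a, b) ∈ internalEdges G ↔ G.Adj a b ∧ Branching G a ∧ Branching G b := by
  simp only [internalEdges, Set.mem_ofPred_eq, SimpleGraph.mem_edgeSet, Sym2.mem_iff,
    forall_eq_or_imp, forall_eq, two_le_degree_iff]

/-- `ctr` sends the leaves to their neighbours and fixes the other vertices, except that one end of a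
component with two vertices is fixed. -/
structure IsLeafMap (G : SimpleGraph V) (ctr : V → V) : Prop where
  idem : ∀ v, ctr (ctr v) = ctr v
  adj : ∀ v, ctr v ≠ v → G.Adj v (ctr v)
  not_branching : ∀ v, ctr v ≠ v → ¬ Branching G v
  branching : ∀ a b, G.Adj a b → ctr a ≠ b → ctr b ≠ a → Branching G a ∧ Branching G b

theorem exists_isLeafMap [Fintype V] (G : SimpleGraph V) : ∃ ctr, IsLeafMap G ctr := by
  -- An arbitrary ordering, needed only to choose the centre of a component consisting of one edge.
  let enc := Fintype.equivFin V
  let P : V → V → Prop := fun v w => G.Adj v w ∧ ¬ Branching G v ∧ (Branching G w ∨ enc w < enc v)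
  let ctr : V → V := fun v => if h : ∃ w, P v w then h.choose else v
  have huniq : ∀ {v a b}, ¬ Branching G v → G.Adj v a → G.Adj v b → a = b := by
    intro v a b hv ha hb
    by_contra h
    exact hv ⟨a, b, ha, hb, h⟩
  have hctr : ∀ v, ctr v ≠ v → P v (ctr v) := by
    intro v hv
    by_cases h : ∃ w, P v w
    · have : ctr v = h.choose := dif_pos h
      rw [this]; exact h.choose_spec
    · exact absurd (dif_neg h) hv
  have hP : ∀ v w, P v w → ctr v = w := by
    intro v w h
    have he : ∃ w, P v w := ⟨w, h⟩
    have : ctr v = he.choose := dif_pos he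
    rw [this]
    exact huniq h.2.1 he.choose_spec.1 h.1
  refine ⟨ctr, ⟨fun v => ?_, fun v hv => (hctr v hv).1, fun v hv => (hctr v hv).2.1, ?_⟩⟩
  · by_cases hv : ctr v = v
    · rw [hv, hv]
    · by_contra hne
      have h1 := hctr v hv
      have h2 := hctr (ctr v) hne
      rcases h1.2.2 with h3 | h3
      · exact h2.2.1 h3
      · have h4 : ctr (ctr v) = v := huniq h2.2.1 h2.1 h1.1.symm
        rw [h4] at h2
        rcases h2.2.2 with h5 | h5
        · exact h1.2.1 h5
        · exact lt_asymm h3 h5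
  · have key : ∀ a b, G.Adj a b → ctr a ≠ b → ctr b ≠ a → Branching G a := by
      intro a b hab h1 h2
      by_contra ha
      have hb : ¬ Branching G b := fun hb => h1 (hP a b ⟨hab, ha, Or.inl hb⟩)
      have h3 : ¬ enc b < enc a := fun h => h1 (hP a b ⟨hab, ha, Or.inr h⟩)
      have h4 : ¬ enc a < enc b := fun h => h2 (hP b a ⟨hab.symm, hb, Or.inr h⟩)
      exact hab.ne (enc.injective (le_antisymm (not_lt.mp h3) (not_lt.mp h4)))
    exact fun a b hab h1 h2 => ⟨key a b hab h1 h2, key b a hab.symm h2 h1⟩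

theorem IsLeafMap.eq_self {G : SimpleGraph V} {ctr : V → V} (h : IsLeafMap G ctr) {v : V}
    (hv : Branching G v) : ctr v = v := by
  by_contra hne; exact h.not_branching v hne hv

theorem IsLeafMap.adj_of_eq {G : SimpleGraph V} {ctr : V → V} (h : IsLeafMap G ctr) {u v : V}
    (huv : u ≠ v) (hu : ctr u = v) : G.Adj u v := by
  have := h.adj u (fun h' => huv (h'.symm.trans hu))
  rwa [hu] at this

/-- All edges at a branching vertex without leaves are internal. -/
theorem IsLeafMap.mem_internalEdges [Fintype V] {G : SimpleGraph V} {ctr : V → V}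
    (h : IsLeafMap G ctr) {v y : V} (hv : Branching G v) (hm : v ∉ marked ctr) (hvy : G.Adj v y) :
    s(v, y) ∈ internalEdges G := by
  have hv' := h.eq_self hv
  refine StarLeading.mem_internalEdges.mpr ⟨hvy, h.branching v y hvy ?_ ?_⟩
  · rw [hv']; exact hvy.ne
  · intro hy
    exact hm ⟨hv', y, hvy.ne.symm, hy⟩

theorem componentPartition_parts [Fintype V] (H : SimpleGraph V) :
    (componentPartition H).parts = ∑ K : H.ConnectedComponent, {K.supp.ncard} := by
  have : (componentPartition H).parts =
      (univ : Finset H.ConnectedComponent).val.map fun K => K.supp.ncard := rfl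
  rw [this, ← Multiset.sum_map_singleton (Multiset.map _ _), Multiset.map_map]
  rfl

/-- After deletion of the internal edges, the remaining edges are exactly those joining `v` to `ctr
v`; the components are thus the fibres of `ctr`, one for each fixed point. -/
theorem IsLeafMap.lambdaLC_parts [Fintype V] {G : SimpleGraph V} {ctr : V → V}
    (h : IsLeafMap G ctr) : (lambdaLC G).parts = starParts ctr := by
  set H := G.deleteEdges (internalEdges G) with hH
  have hadj : ∀ a b, H.Adj a b ↔ a ≠ b ∧ (ctr a = b ∨ ctr b = a) := by
    intro a b
    rw [hH, SimpleGraph.deleteEdges_adj, StarLeading.mem_internalEdges]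
    constructor
    · rintro ⟨h1, h2⟩
      refine ⟨h1.ne, ?_⟩
      by_contra! h3
      exact h2 ⟨h1, h.branching a b h1 h3.1 h3.2⟩
    · rintro ⟨hne, h1 | h1⟩
      · refine ⟨h.adj_of_eq hne h1, fun h2 => h.not_branching a ?_ h2.2.1⟩
        rw [h1]; exact hne.symm
      · refine ⟨(h.adj_of_eq hne.symm h1).symm, fun h2 => h.not_branching b ?_ h2.2.2⟩
        rw [h1]; exact hne
  have hreach : ∀ a b, H.Reachable a b ↔ ctr a = ctr b := by
    intro a b
    constructor
    · rintro ⟨p⟩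
      induction p with
      | nil => rfl
      | cons hab _ ih =>
        rcases ((hadj _ _).mp hab).2 with h1 | h1
        · rw [← ih, ← h1, h.idem]
        · rw [← ih, ← h1, h.idem]
    · have key : ∀ a, H.Reachable a (ctr a) := by
        intro a
        by_cases ha : a = ctr a
        · rw [← ha]
        · exact ((hadj _ _).mpr ⟨ha, Or.inl rfl⟩).reachable
      intro hab
      have := key a
      rw [hab] at this
      exact this.trans (key b).symm
  have hparts : (lambdaLC G).parts = ∑ K : H.ConnectedComponent, {K.supp.ncard} := by
    rw [lambdaLC, componentPartition_parts]
    congr!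
  rw [hparts, starParts]
  symm
  refine sum_bij (fun v _ => H.connectedComponentMk v) (fun v _ => mem_univ _) ?_ ?_ ?_
  · intro a ha b hb hab
    rw [SimpleGraph.ConnectedComponent.eq, hreach, (mem_filter.mp ha).2, (mem_filter.mp hb).2] at hab
    exact hab
  · intro K _
    induction K using SimpleGraph.ConnectedComponent.ind with
    | h v =>
      refine ⟨ctr v, mem_filter.mpr ⟨mem_univ _, h.idem v⟩, ?_⟩
      rw [SimpleGraph.ConnectedComponent.eq, hreach, h.idem]
  · intro v hv
    have hv := (mem_filter.mp hv).2
    have : (H.connectedComponentMk v).supp = insert v {u | ctr u ≠ u ∧ ctr u = v} := by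
      ext u
      rw [SimpleGraph.ConnectedComponent.mem_supp_iff, SimpleGraph.ConnectedComponent.eq, hreach, hv,
        Set.mem_insert_iff, Set.mem_ofPred_eq]
      constructor
      · intro hu
        by_cases huv : u = v
        · exact Or.inl huv
        · exact Or.inr ⟨fun h' => huv (h'.symm.trans hu), hu⟩
      · rintro (rfl | hu)
        · exact hv
        · exact hu.2
    rw [this, Set.ncard_insert_of_notMem _ (Set.toFinite _), leafCount, add_comm]
    exact fun hmem => hmem.1 hv

/-- The vertices outside `U` that lie on an edge of `E`. -/
def touched (E : Finset (Sym2 V)) (U : Set V) : Set V := {v | v ∉ U ∧ ∃ e ∈ E, v ∈ e}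

/-- Vertices on no edge of `E` are isolated and may be put into `U` freely. The vertices left
outside are then only those for which a degree bound is available. -/
theorem sepSum_compl_touched (E : Finset (Sym2 V)) (U : Set V) :
    sepSum E (touched E U)ᶜ = sepSum E U := by
  have hU : U ⊆ (touched E U)ᶜ := fun v hv h => h.1 hv
  refine sum_congr rfl fun A hA => ?_
  have : Separates A (touched E U)ᶜ ↔ Separates A U := by
    refine ⟨fun h u hu u' hu' hr => h u (hU hu) u' (hU hu') hr, fun h u hu u' hu' hr => ?_⟩
    by_contra hne
    have key : ∀ a b, (edgeGraph A).Reachable a b → a ≠ b → a ∈ (touched E U)ᶜ → a ∈ U := by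
      intro a b hr hne ha
      obtain ⟨e, he, hae⟩ := exists_edge_of_reachable_ne hr hne
      by_contra haU
      exact ha ⟨haU, e, mem_powerset.mp hA he, hae⟩
    exact hne (h u (key u u' hr hne hu) u' (key u' u hr.symm (Ne.symm hne) hu') hr)
  simp only [this]

theorem two_le_edgeDeg {E : Finset (Sym2 V)} {v a b : V} (ha : s(v, a) ∈ E) (hb : s(v, b) ∈ E)
    (hab : a ≠ b) : 2 ≤ edgeDeg E v := by
  refine one_lt_card.mpr ⟨s(v, a), ?_, s(v, b), ?_, ?_⟩
  · exact mem_filter.mpr ⟨ha, Sym2.mem_mk_left _ _⟩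
  · exact mem_filter.mpr ⟨hb, Sym2.mem_mk_left _ _⟩
  · intro h; exact hab (Sym2.congr_right.mp h)

/-- Paths in a forest are unique, so the first edge of a path in `A` would also belong to `B`. -/
theorem reachable_false_of_isAcyclic_union {A B : Finset (Sym2 V)} (hdisj : Disjoint A B)
    (hac : (edgeGraph (A ∪ B)).IsAcyclic) {u v : V} (hne : u ≠ v)
    (hA : (edgeGraph A).Reachable u v) (hB : (edgeGraph B).Reachable u v) : False := by
  obtain ⟨p, hp⟩ := hA.exists_isPath
  obtain ⟨q, hq⟩ := hB.exists_isPath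
  have hAl : edgeGraph A ≤ edgeGraph (A ∪ B) := edgeGraph_mono subset_union_left
  have hBl : edgeGraph B ≤ edgeGraph (A ∪ B) := edgeGraph_mono subset_union_right
  have h := (hac.subsingleton_path u v).elim ⟨p.mapLe hAl, hp.mapLe hAl⟩ ⟨q.mapLe hBl, hq.mapLe hBl⟩
  have h' : p.edges = q.edges := by
    have := congrArg (fun r : (edgeGraph (A ∪ B)).Path u v => r.1.edges) h
    simpa using this
  cases p with
  | nil => exact hne rfl
  | @cons _ w _ hadj p =>
    have h1 : s(u, w) ∈ A := by
      have := ((SimpleGraph.fromEdgeSet_adj _).mp hadj).1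
      exact_mod_cast this
    have h2 : s(u, w) ∈ q.edges := by rw [← h']; simp
    have h3 := q.edges_subset_edgeSet h2
    rw [SimpleGraph.mem_edgeSet, SimpleGraph.fromEdgeSet_adj] at h3
    exact disjoint_left.mp hdisj h1 (by exact_mod_cast h3.1)

/-! ### Unicyclic graphs and the case of at least two non-trivial trees -/

variable {G : SimpleGraph V}

theorem IsUnicyclic.isAcyclic_deleteEdges (hG : IsUnicyclic G) {v : V} {p : G.Walk v v}
    (hp : p.IsCycle) {e : Sym2 V} (he : e ∈ p.edges) : (G.deleteEdges {e}).IsAcyclic := by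
  intro u q hq
  have hle : G.deleteEdges {e} ≤ G := SimpleGraph.deleteEdges_le _
  have h := hG.unique ⟨u, q.mapLe hle, hq.mapLe hle, rfl⟩ ⟨v, p, hp, rfl⟩
  have h1 : e ∈ (q.mapLe hle).edges := by
    rw [← SimpleGraph.Walk.mem_edges_toSubgraph, h, SimpleGraph.Walk.mem_edges_toSubgraph]
    exact he
  have h2 : e ∈ q.edges := by simpa using h1
  have h3 := q.edges_subset_edgeSet h2
  rw [SimpleGraph.edgeSet_deleteEdges] at h3
  exact h3.2 rfl

theorem edgeGraph_isAcyclic_of_notMem {e : Sym2 V} (h : (G.deleteEdges {e}).IsAcyclic)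
    {E : Finset (Sym2 V)} (hE : ∀ f ∈ E, f ∈ G.edgeSet) (he : e ∉ E) : (edgeGraph E).IsAcyclic := by
  refine h.anti fun a b hab => ?_
  rw [SimpleGraph.fromEdgeSet_adj] at hab
  rw [SimpleGraph.deleteEdges_adj]
  refine ⟨hE _ hab.1, fun h' => he ?_⟩
  rw [← Set.mem_singleton_iff.mp h']
  exact hab.1

theorem branching_of_mem_support {v : V} {p : G.Walk v v} (hp : p.IsCycle) {x : V}
    (hx : x ∈ p.support) : Branching G x := by
  obtain ⟨a, b, hab, h⟩ := Set.ncard_eq_two.mp (hp.ncard_neighborSet_toSubgraph_eq_two hx)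
  have ha : a ∈ p.toSubgraph.neighborSet x := by rw [h]; simp
  have hb : b ∈ p.toSubgraph.neighborSet x := by rw [h]; simp
  exact ⟨a, b, p.toSubgraph.adj_sub ha, p.toSubgraph.adj_sub hb, hab⟩

theorem reachable_edgeGraph_edges {u v : V} (p : G.Walk u v) {x y : V} (hx : x ∈ p.support)
    (hy : y ∈ p.support) : (edgeGraph p.edges.toFinset).Reachable x y := by
  have hq : ∀ e ∈ p.edges, e ∈ (edgeGraph p.edges.toFinset).edgeSet := by
    intro e he
    rw [SimpleGraph.edgeSet_fromEdgeSet]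
    exact ⟨by simpa using he, G.not_isDiag_of_mem_edgeSet (p.edges_subset_edgeSet he)⟩
  have key : ∀ x ∈ p.support, (edgeGraph p.edges.toFinset).Reachable u x := fun x hx =>
    ((p.transfer _ hq).takeUntil x (by rwa [SimpleGraph.Walk.support_transfer])).reachable
  exact (key x hx).symm.trans (key y hy)

/-- An edge of a cycle is not a bridge, so any walk round the cycle can be rerouted past `e`. -/
theorem reachable_edgeGraph_erase {v : V} {p : G.Walk v v} (hp : p.IsCycle) {e : Sym2 V}
    (he : e ∈ p.edges) {x y : V} (hx : x ∈ p.support) (hy : y ∈ p.support) :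
    (edgeGraph (p.edges.toFinset.erase e)).Reachable x y := by
  have hq : ∀ e ∈ p.edges, e ∈ (edgeGraph p.edges.toFinset).edgeSet := by
    intro e he
    rw [SimpleGraph.edgeSet_fromEdgeSet]
    exact ⟨by simpa using he, G.not_isDiag_of_mem_edgeSet (p.edges_subset_edgeSet he)⟩
  have hle : (edgeGraph p.edges.toFinset).deleteEdges {e} ≤
      edgeGraph (p.edges.toFinset.erase e) := by
    intro a b hab
    rw [SimpleGraph.deleteEdges_adj, SimpleGraph.fromEdgeSet_adj] at hab
    rw [SimpleGraph.fromEdgeSet_adj]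
    refine ⟨?_, hab.1.2⟩
    exact_mod_cast mem_erase.mpr ⟨hab.2, by exact_mod_cast hab.1.1⟩
  induction e using Sym2.ind with
  | _ a b =>
    have hab := (SimpleGraph.adj_and_reachable_delete_edges_iff_exists_cycle
      (G := edgeGraph p.edges.toFinset) (v := a) (w := b)).mpr
      ⟨v, p.transfer _ hq, hp.transfer hq, by rwa [SimpleGraph.Walk.edges_transfer]⟩
    have hab' := hab.2.mono hle
    refine reachable_map id (fun c d hcd => ?_) (reachable_edgeGraph_edges p hx hy)
    by_cases hc : s(c, d) = s(a, b)
    · rcases Sym2.eq_iff.mp hc with ⟨rfl, rfl⟩ | ⟨rfl, rfl⟩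
      exacts [hab', hab'.symm]
    · refine (hle ?_).reachable
      rw [SimpleGraph.deleteEdges_adj]
      exact ⟨hcd, hc⟩

theorem exists_adj_notMem_of_nontrivialRoots {C : G.Subgraph} {v : V} (hv : v ∈ nontrivialRoots C) :
    ∃ y, G.Adj v y ∧ s(v, y) ∉ C.edgeSet := by
  obtain ⟨u, hu, hne⟩ := hv.2.exists_ne v
  rw [rootedTree, SimpleGraph.ConnectedComponent.mem_supp_iff,
    SimpleGraph.ConnectedComponent.eq] at hu
  obtain ⟨p⟩ := hu.symm
  cases p with
  | nil => exact absurd rfl hne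
  | @cons _ y _ hadj _ =>
    rw [SimpleGraph.deleteEdges_adj] at hadj
    exact ⟨y, hadj⟩

theorem mem_nontrivialRoots {C : G.Subgraph} {v y : V} (hv : v ∈ C.verts) (hy : G.Adj v y)
    (hC : s(v, y) ∉ C.edgeSet) : v ∈ nontrivialRoots C := by
  refine ⟨hv, v, rfl, y, ?_, hy.ne⟩
  rw [rootedTree, SimpleGraph.ConnectedComponent.mem_supp_iff, SimpleGraph.ConnectedComponent.eq]
  exact SimpleGraph.Adj.reachable ((SimpleGraph.deleteEdges_adj).mpr ⟨hy.symm, by rwa [Sym2.eq_swap]⟩)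

/-- The internal edges as a finite set. -/
noncomputable def internalFinset [Fintype V] (G : SimpleGraph V) : Finset (Sym2 V) :=
  (Set.toFinite (internalEdges G)).toFinset

theorem mem_internalFinset [Fintype V] {G : SimpleGraph V} {e : Sym2 V} :
    e ∈ internalFinset G ↔ e ∈ internalEdges G := Set.Finite.mem_toFinset _

theorem internalFinset_sub [Fintype V] {e : Sym2 V} (he : e ∈ internalFinset G) : e ∈ G.edgeSet :=
  (mem_internalFinset.mp he).1

theorem branching_of_mem_internalFinset [Fintype V] {e : Sym2 V} (he : e ∈ internalFinset G) {v : V}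
    (hv : v ∈ e) : Branching G v := by
  obtain ⟨y, rfl⟩ := hv
  exact (mem_internalEdges.mp (mem_internalFinset.mp he)).2.1

theorem IsLeafMap.two_le_edgeDeg [Fintype V] {ctr : V → V} (h : IsLeafMap G ctr) {v : V}
    (hv : v ∈ touched (internalFinset G) (marked ctr)) : 2 ≤ edgeDeg (internalFinset G) v := by
  obtain ⟨hm, e, he, hve⟩ := hv
  have hb := branching_of_mem_internalFinset he hve
  obtain ⟨a, b, ha, hb', hab⟩ := id hb
  exact StarLeading.two_le_edgeDeg (mem_internalFinset.mpr (h.mem_internalEdges hb hm ha))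
    (mem_internalFinset.mpr (h.mem_internalEdges hb hm hb')) hab

/-- All cycle edges are internal, so the internal edges split into the cycle `CE` and a forest `E`,
and `sepSum_strip` applies with threshold 2. -/
theorem isLeadingPartition_of_two_le [Fintype V] (hG : IsUnicyclic G) {v₀ : V} {p : G.Walk v₀ v₀}
    (hp : p.IsCycle) (hr : 2 ≤ (nontrivialRoots p.toSubgraph).ncard) :
    IsLeadingPartition (csf G) (lambdaLC G) := by
  obtain ⟨ctr, hctr⟩ := exists_isLeafMap G
  set I := internalFinset G with hI
  have hlead := hasLead_gen hctr.idem ∅ I (by simp)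
    (fun e he v hv => hctr.eq_self (branching_of_mem_internalFinset he hv))
  have hcsf : csf G = gen fun κ : V → ℕ => ((∀ v, ctr v ≠ v → κ v ≠ κ (ctr v)) ∧
      ∀ e ∈ (∅ : Finset (Sym2 V)), Mono κ e) ∧ ∀ e ∈ I, ¬ Mono κ e := by
    rw [csf_eq_gen]
    refine gen_congr fun κ => ⟨fun h => ⟨⟨fun v hv => h _ _ (hctr.adj v hv), by simp⟩, ?_⟩, ?_⟩
    · intro e he
      induction e using Sym2.ind with
      | _ a b => rw [mono_mk]; exact h a b (internalFinset_sub he)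
    · rintro ⟨⟨h1, -⟩, h2⟩ a b hab
      by_cases ha : ctr a = b
      · have := h1 a (by rw [ha]; exact hab.ne.symm)
        rwa [ha] at this
      · by_cases hb : ctr b = a
        · have := h1 b (by rw [hb]; exact hab.ne)
          rw [hb] at this
          exact this.symm
        · have := h2 s(a, b) (mem_internalFinset.mpr
            (mem_internalEdges.mpr ⟨hab, hctr.branching a b hab ha hb⟩))
          rwa [mono_mk] at this
  rw [← hcsf, ← hctr.lambdaLC_parts] at hlead
  refine hlead.isLeadingPartition ?_
  simp only [empty_union]
  change sepSum I (marked ctr) ≠ 0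
  rw [← sepSum_compl_touched]
  set U := (touched I (marked ctr))ᶜ with hU
  set CE := p.edges.toFinset with hCE
  have hCEI : CE ⊆ I := by
    intro e he
    rw [hCE, List.mem_toFinset] at he
    induction e using Sym2.ind with
    | _ a b => exact mem_internalFinset.mpr (mem_internalEdges.mpr ⟨p.edges_subset_edgeSet he,
        branching_of_mem_support hp (p.fst_mem_support_of_mem_edges he),
        branching_of_mem_support hp (p.snd_mem_support_of_mem_edges he)⟩)
  set E := I \ CE with hE
  have hunion : CE ∪ E = I := union_sdiff_of_subset hCEI
  have hdisj : Disjoint CE E := disjoint_sdiff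
  have hdiag : ∀ e ∈ I, ¬ e.IsDiag := fun e he =>
    G.not_isDiag_of_mem_edgeSet (internalFinset_sub he)
  have hac : ∀ e ∈ CE, ∀ E' ⊆ I, e ∉ E' → (edgeGraph E').IsAcyclic := fun e he E' hE' heE' =>
    edgeGraph_isAcyclic_of_notMem (hG.isAcyclic_deleteEdges hp (List.mem_toFinset.mp he))
      (fun f hf => internalFinset_sub (hE' hf)) heE'
  obtain ⟨f, hf⟩ : CE.Nonempty := by
    obtain ⟨e, he⟩ := p.edges.exists_mem_of_ne_nil (by simp [hp.not_nil])
    exact ⟨e, List.mem_toFinset.mpr he⟩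
  let S : Set V := {v | v ∈ p.support}
  have hCES : ∀ e ∈ CE, ∀ v ∈ e, v ∈ S := by
    rintro e he v ⟨y, rfl⟩
    exact p.fst_mem_support_of_mem_edges (List.mem_toFinset.mp he)
  have hSCE : ∀ v ∈ S, ∃ e ∈ CE, v ∈ e := by
    intro v hv
    obtain ⟨e, he, hve⟩ := (p.mem_support_iff_exists_mem_edges_of_not_nil hp.not_nil).mp hv
    exact ⟨e, List.mem_toFinset.mpr he, hve⟩
  have hconn : ∀ e ∈ CE, ∀ u ∈ S, ∀ v ∈ S, (edgeGraph (CE.erase e)).Reachable u v :=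
    fun e he u hu v hv => reachable_edgeGraph_erase hp (List.mem_toFinset.mp he) hu hv
  have hbase := sepSum_cycle (fun e he => hdiag e (hCEI he)) ⟨f, hf⟩ hCES hSCE
    (fun e he => hac e he _ ((erase_subset _ _).trans hCEI) (notMem_erase _ _)) hconn
  -- Two cycle vertices joined off the cycle would also be joined along the cycle without `f`,
  -- giving a second route in a forest.
  have hsep : Separates E S := by
    intro u hu u' hu' hr
    by_contra hne
    refine reachable_false_of_isAcyclic_union (A := CE.erase f) (B := E)
      (disjoint_of_subset_left (erase_subset _ _) hdisj) (hac f hf _ ?_ ?_) hne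
      (hconn f hf u hu u' hu') hr
    · exact union_subset ((erase_subset _ _).trans hCEI) sdiff_subset
    · rw [mem_union, not_or]
      exact ⟨notMem_erase _ _, fun h => disjoint_left.mp hdisj hf h⟩
  have hmain := (sepSum_strip hCES 2 hbase E.card E rfl hdisj
    (fun e he => hdiag e (sdiff_subset he))
    (hac f hf _ sdiff_subset fun h => disjoint_left.mp hdisj hf h) hsep U (by
      intro v hv
      rw [hunion]
      exact hctr.two_le_edgeDeg (by simpa [hU] using hv))).2
  rw [hunion] at hmain
  have hpos := hmain (hr.trans (Set.ncard_le_ncard ?_ (Set.toFinite _)))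
  · intro h0
    rw [h0, mul_zero] at hpos
    exact lt_irrefl _ hpos
  · intro v hv
    have hvS : v ∈ p.support := p.mem_verts_toSubgraph.mp hv.1
    refine ⟨hvS, ?_⟩
    obtain ⟨y, hvy, hyC⟩ := exists_adj_notMem_of_nontrivialRoots hv
    by_cases hm : v ∈ marked ctr
    · exact Or.inl fun h => h.1 hm
    -- An unmarked root has only internal edges, so its edge leaving the cycle belongs to `E`.
    · refine Or.inr ⟨s(v, y), mem_sdiff.mpr ⟨mem_internalFinset.mpr
        (hctr.mem_internalEdges (branching_of_mem_support hp hvS) hm hvy), fun h => hyC ?_⟩,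
        Sym2.mem_mk_left _ _⟩
      rw [SimpleGraph.Walk.mem_edges_toSubgraph]
      exact List.mem_toFinset.mp h

end Graph

end StarLeading

/-! ### A cycle with a single non-trivial tree -/

namespace StarLeading
open Finset
open scoped Classical

/-- The map `ρ` contracts the edges of `F` and moves neither `U` nor the edges of `A`, so it carries
walks in `F ∪ A` to walks in `A`. -/
theorem separates_union_iff {V : Type*} {F A : Finset (Sym2 V)} {U : Set V} (ρ : V → V)
    (hU : ∀ u ∈ U, ρ u = u) (hF : ∀ a b, s(a, b) ∈ F → ρ a = ρ b)
    (hA : ∀ e ∈ A, ∀ v ∈ e, ρ v = v) : Separates (F ∪ A) U ↔ Separates A U := by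
  refine ⟨fun h => h.mono subset_union_right, fun h u hu u' hu' hr => ?_⟩
  have := reachable_map (H := edgeGraph A) ρ (fun a b hab => ?_) hr
  · rw [hU u hu, hU u' hu'] at this
    exact h u hu u' hu' this
  · rw [SimpleGraph.fromEdgeSet_adj] at hab
    rcases mem_union.mp (mem_coe.mp hab.1) with h1 | h1
    · rw [hF a b h1]
    · rw [hA _ h1 a (Sym2.mem_mk_left _ _), hA _ h1 b (Sym2.mem_mk_right _ _)]
      exact SimpleGraph.Adj.reachable ((SimpleGraph.fromEdgeSet_adj _).mpr ⟨h1, hab.2⟩)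

theorem MultLT.of_add_right {lam μ ν : Multiset ℕ} (h : MultLT (lam + ν) (μ + ν)) :
    MultLT lam μ := by
  obtain ⟨k, h1, h2⟩ := h
  exact ⟨k, by simpa using h1, fun j hj => by simpa using h2 j hj⟩

section Tail

variable {V : Type*} {ctr : V → V} {a b : V}

theorem idem_update (hctr : ∀ v, ctr (ctr v) = ctr v) (hab : a ≠ b) (hb : ctr b = b)
    (hm : a ∉ marked ctr) (ha : ctr a = a) (v : V) :
    Function.update ctr a b (Function.update ctr a b v) = Function.update ctr a b v := by
  by_cases hv : v = a
  · rw [hv, Function.update_self, Function.update_of_ne hab.symm, hb]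
  · rw [Function.update_of_ne hv, Function.update_of_ne, hctr]
    exact fun h => hm ⟨ha, v, hv, h⟩

theorem marked_update (hab : a ≠ b) (ha : ctr a = a) (hb : ctr b = b) (hm : a ∉ marked ctr) :
    marked (Function.update ctr a b) = insert b (marked ctr) := by
  ext v
  simp only [marked, Set.mem_ofPred_eq, Set.mem_insert_iff]
  constructor
  · rintro ⟨hv, u, hu, huv⟩
    by_cases hua : u = a
    · rw [hua, Function.update_self] at huv
      exact Or.inl huv.symm
    · rw [Function.update_of_ne hua] at huv
      by_cases hva : v = a
      · rw [hva, Function.update_self] at hv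
        exact absurd hv.symm hab
      · rw [Function.update_of_ne hva] at hv
        exact Or.inr ⟨hv, u, hu, huv⟩
  · rintro (rfl | ⟨hv, u, hu, huv⟩)
    · exact ⟨by rw [Function.update_of_ne hab.symm, hb], a, hab, Function.update_self ..⟩
    · have hva : v ≠ a := by
        rintro rfl
        exact hm ⟨hv, u, hu, huv⟩
      have hua : u ≠ a := by
        rintro rfl
        exact hu (ha.symm.trans huv)
      exact ⟨by rw [Function.update_of_ne hva, hv], u, hu, by rw [Function.update_of_ne hua, huv]⟩

/-- The one-vertex star at `a` is absorbed by the star at `b`. Writing the change additively avoids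
subtraction of multisets. -/
theorem starParts_update [Fintype V] (hab : a ≠ b) (ha : ctr a = a) (hb : ctr b = b)
    (hm : a ∉ marked ctr) :
    starParts (Function.update ctr a b) + ({1} + {1 + leafCount ctr b}) =
      starParts ctr + {2 + leafCount ctr b} := by
  have hfix : (univ.filter fun v => Function.update ctr a b v = v) =
      (univ.filter fun v => ctr v = v).erase a := by
    ext v
    simp only [mem_filter, mem_univ, true_and, mem_erase]
    by_cases hv : v = a
    · rw [hv, Function.update_self]; simp [hab.symm]
    · rw [Function.update_of_ne hv]; simp [hv]
  have ha0 : leafCount ctr a = 0 := by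
    by_contra h
    exact hm ((leafCount_pos ha).mp (Nat.pos_of_ne_zero h))
  have hb1 : leafCount (Function.update ctr a b) b = leafCount ctr b + 1 := by
    have : {u | Function.update ctr a b u ≠ u ∧ Function.update ctr a b u = b} =
        insert a {u | ctr u ≠ u ∧ ctr u = b} := by
      ext u
      rw [Set.mem_insert_iff, Set.mem_ofPred_eq, Set.mem_ofPred_eq]
      by_cases hu : u = a
      · rw [hu, Function.update_self]; simp [hab.symm]
      · rw [Function.update_of_ne hu]; simp [hu]
    rw [leafCount, this, Set.ncard_insert_of_notMem _ (Set.toFinite _), leafCount]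
    exact fun h => h.1 ha
  have hv1 : ∀ v, v ≠ b → leafCount (Function.update ctr a b) v = leafCount ctr v := by
    intro v hv
    rw [leafCount, leafCount]
    congr 1
    ext u
    rw [Set.mem_ofPred_eq, Set.mem_ofPred_eq]
    by_cases hu : u = a
    · rw [hu, Function.update_self, ha]; simp [hv.symm]
    · rw [Function.update_of_ne hu]
  have hmema : a ∈ univ.filter fun v => ctr v = v := mem_filter.mpr ⟨mem_univ _, ha⟩
  have hmemb : b ∈ (univ.filter fun v => ctr v = v).erase a :=
    mem_erase.mpr ⟨hab.symm, mem_filter.mpr ⟨mem_univ _, hb⟩⟩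
  rw [starParts, starParts, hfix, ← sum_erase_add _ _ hmema, ← sum_erase_add _ _ hmemb,
    ← sum_erase_add _ _ hmemb, hb1, ha0,
    sum_congr rfl fun v hv => by rw [hv1 v (ne_of_mem_erase hv)]]
  rw [show 1 + (leafCount ctr b + 1) = 2 + leafCount ctr b by ring, add_zero]
  abel

end Tail

/-- The vertices `c 0, …, c k = c 0` go round a cycle that is attached to the rest of the graph only
at `c 0`. -/
structure PendantCycle {V : Type*} (G : SimpleGraph V) (k : ℕ) (c : ℕ → V) : Prop where
  three_le : 3 ≤ k
  closed : c k = c 0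
  inj : ∀ i j, i < k → j < k → c i = c j → i = j
  adj : ∀ i < k, G.Adj (c i) (c (i + 1))
  nbr : ∀ j, j + 1 < k → ∀ y, G.Adj (c (j + 1)) y → y = c j ∨ y = c (j + 2)
  root : ∃ y, G.Adj (c 0) y ∧ y ≠ c 1 ∧ y ≠ c (k - 1)
  acyclic : (G.deleteEdges {s(c 0, c 1)}).IsAcyclic

/-- The first `m` edges of the cycle. -/
noncomputable def firstEdges {V : Type*} (c : ℕ → V) (m : ℕ) : Finset (Sym2 V) :=
  (range m).image fun j => s(c j, c (j + 1))

theorem mem_firstEdges {V : Type*} {c : ℕ → V} {m : ℕ} {e : Sym2 V} :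
    e ∈ firstEdges c m ↔ ∃ j < m, s(c j, c (j + 1)) = e := by
  simp [firstEdges]

namespace PendantCycle

variable {V : Type*} {G : SimpleGraph V} {k : ℕ} {c : ℕ → V}

theorem inj' (h : PendantCycle G k c) {i j : ℕ} (hi : 1 ≤ i) (hi' : i ≤ k) (hj : 1 ≤ j)
    (hj' : j ≤ k) (hij : c i = c j) : i = j := by
  rcases hi'.lt_or_eq with h1 | rfl
  · rcases hj'.lt_or_eq with h2 | rfl
    · exact h.inj i j h1 h2 hij
    · rw [h.closed] at hij
      have := h.inj i 0 h1 (by omega) hij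
      omega
  · rcases hj'.lt_or_eq with h2 | rfl
    · rw [h.closed] at hij
      have := h.inj 0 j (by omega) h2 hij
      omega
    · rfl

theorem edge_inj (h : PendantCycle G k c) {i j : ℕ} (hi : i < k) (hj : j < k)
    (hij : s(c i, c (i + 1)) = s(c j, c (j + 1))) : i = j := by
  rcases Sym2.eq_iff.mp hij with ⟨h1, _⟩ | ⟨h1, h2⟩
  · exact h.inj i j hi hj h1
  · exfalso
    have h3 := h.three_le
    rcases Nat.lt_or_ge (i + 1) k with hi' | hi'
    · have := h.inj (i + 1) j hi' hj h2
      rcases Nat.lt_or_ge (j + 1) k with hj' | hj'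
      · have := h.inj i (j + 1) hi hj' h1
        omega
      · have e : j + 1 = k := by omega
        rw [e, h.closed] at h1
        have := h.inj i 0 hi (by omega) h1
        omega
    · have e : i + 1 = k := by omega
      rw [e, h.closed] at h2
      have hj0 := h.inj 0 j (by omega) hj h2
      have := h.inj i (j + 1) hi (by omega) h1
      omega

theorem branching (h : PendantCycle G k c) {j : ℕ} (hj : j ≤ k) : Branching G (c j) := by
  have h3 := h.three_le
  have h0 : Branching G (c 0) := by
    have hk := h.adj (k - 1) (by omega)
    rw [show k - 1 + 1 = k by omega, h.closed] at hk
    refine ⟨c 1, c (k - 1), h.adj 0 (by omega), hk.symm, fun he => ?_⟩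
    have := h.inj 1 (k - 1) (by omega) (by omega) he
    omega
  rcases hj.lt_or_eq with hj' | rfl
  · rcases Nat.eq_zero_or_pos j with rfl | hp
    · exact h0
    · obtain ⟨i, rfl⟩ : ∃ i, j = i + 1 := ⟨j - 1, by omega⟩
      refine ⟨c i, c (i + 2), (h.adj i (by omega)).symm, h.adj (i + 1) hj', fun he => ?_⟩
      rcases Nat.lt_or_ge (i + 2) k with h1 | h1
      · have := h.inj i (i + 2) (by omega) h1 he
        omega
      · rw [show i + 2 = k by omega, h.closed] at he
        have := h.inj i 0 (by omega) (by omega) he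
        omega
  · rw [h.closed]; exact h0

theorem notMem_marked (h : PendantCycle G k c) {ctr : V → V} (hctr : IsLeafMap G ctr) {j : ℕ}
    (hj : 1 ≤ j) (hjk : j < k) : c j ∉ marked ctr := by
  rintro ⟨-, u, hu, huj⟩
  obtain ⟨i, rfl⟩ : ∃ i, j = i + 1 := ⟨j - 1, by omega⟩
  have hb : Branching G u := by
    rcases h.nbr i hjk u (hctr.adj_of_eq hu huj).symm with rfl | rfl
    · exact h.branching (by omega)
    · exact h.branching (by omega)
  exact hu ((hctr.eq_self hb).symm.trans huj)

theorem edge_mem_firstEdges (h : PendantCycle G k c) {j m : ℕ} (hj : 1 ≤ j) (hjm : j < m)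
    (hjk : j < k) {e : Sym2 V} (he : e ∈ G.edgeSet) (hje : c j ∈ e) : e ∈ firstEdges c m := by
  obtain ⟨y, rfl⟩ := hje
  obtain ⟨i, rfl⟩ : ∃ i, j = i + 1 := ⟨j - 1, by omega⟩
  rw [mem_firstEdges]
  rcases h.nbr i hjk y he with rfl | rfl
  · exact ⟨i, by omega, Sym2.eq_swap⟩
  · exact ⟨i + 1, hjm, rfl⟩

/-- Colourings in which the first `i` edges of the cycle are monochromatic, the following `m - i` edges
are arbitrary, and the other edges are properly coloured. -/
def Partial (G : SimpleGraph V) (c : ℕ → V) (i m : ℕ) (κ : V → ℕ) : Prop :=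
  (∀ a b, G.Adj a b → s(a, b) ∉ firstEdges c m → κ a ≠ κ b) ∧ ∀ e ∈ firstEdges c i, Mono κ e

theorem gen_partial [Fintype V] (h : PendantCycle G k c) {i : ℕ} (hi : i < k) :
    gen (Partial G c i i) = gen (Partial G c i (i + 1)) - gen (Partial G c (i + 1) (i + 1)) := by
  have hsucc : ∀ e, e ∈ firstEdges c (i + 1) ↔ e = s(c i, c (i + 1)) ∨ e ∈ firstEdges c i := by
    intro e
    rw [firstEdges, range_add_one, image_insert, mem_insert]
    rfl
  have hn : s(c i, c (i + 1)) ∉ firstEdges c i := by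
    rw [mem_firstEdges]
    rintro ⟨j, hj, he⟩
    exact hj.ne (h.edge_inj (hj.trans hi) hi he)
  rw [← gen_and_add_gen_and_not (Partial G c i (i + 1)) fun κ => Mono κ s(c i, c (i + 1))]
  rw [gen_congr (P := fun κ => Partial G c i (i + 1) κ ∧ Mono κ s(c i, c (i + 1)))
    (Q := Partial G c (i + 1) (i + 1)), add_sub_cancel_left]
  · refine gen_congr fun κ => ?_
    constructor
    · rintro ⟨h1, h2⟩
      refine ⟨⟨fun a b hab he => h1 a b hab fun h' => he ((hsucc _).mpr (Or.inr h')), h2⟩, ?_⟩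
      rw [mono_mk]
      exact h1 _ _ (h.adj i hi) hn
    · rintro ⟨⟨h1, h2⟩, h3⟩
      refine ⟨fun a b hab he => ?_, h2⟩
      by_cases hab' : s(a, b) = s(c i, c (i + 1))
      · rwa [← hab', mono_mk] at h3
      · exact h1 a b hab fun h' => ((hsucc _).mp h').elim hab' he
  · intro κ
    simp only [Partial, hsucc, forall_eq_or_imp]
    tauto

/-- All but one edge of the cycle being monochromatic makes the last edge monochromatic too, whereas
it is required to be proper. -/
theorem gen_partial_last [Fintype V] (h : PendantCycle G k c) :
    gen (Partial G c (k - 1) (k - 1)) = 0 := by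
  have h3 := h.three_le
  refine gen_of_forall_not fun κ hκ => ?_
  have key : ∀ j, j ≤ k - 1 → κ (c j) = κ (c 0) := by
    intro j
    induction j with
    | zero => intro _; rfl
    | succ j ih =>
      intro hj
      rw [← ih (by omega)]
      exact ((mono_mk κ _ _).mp (hκ.2 _ (mem_firstEdges.mpr ⟨j, by omega, rfl⟩))).symm
  have hadj := h.adj (k - 1) (by omega)
  refine hκ.1 _ _ hadj ?_ ?_
  · rw [mem_firstEdges]
    rintro ⟨j, hj, he⟩
    exact hj.ne (h.edge_inj (by omega) (by omega) he)
  · rw [key _ le_rfl, show k - 1 + 1 = k by omega, h.closed]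

/-- Iterating `gen_partial` imposes properness of one cycle edge after another; the remainder
vanishes after k - 1 steps. -/
theorem csf_eq_sum [Fintype V] (h : PendantCycle G k c) :
    csf G = ∑ i ∈ range (k - 1), (-1 : ℚ) ^ i • gen (Partial G c i (i + 1)) := by
  have key : ∀ m, m ≤ k - 1 → csf G = ∑ i ∈ range m, (-1 : ℚ) ^ i • gen (Partial G c i (i + 1)) +
      (-1 : ℚ) ^ m • gen (Partial G c m m) := by
    intro m
    induction m with
    | zero =>
      intro _
      rw [csf_eq_gen, range_zero, sum_empty, zero_add, pow_zero, one_smul]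
      refine gen_congr fun κ => ?_
      simp [Partial, firstEdges]
    | succ m ih =>
      intro hm
      rw [ih (by omega), h.gen_partial (i := m) (by omega), sum_range_succ, smul_sub, pow_succ,
        mul_neg_one, neg_smul]
      abel
  rw [key (k - 1) le_rfl, h.gen_partial_last, smul_zero, add_zero]

/-- The internal edges after the first `i + 2` edges of the cycle. -/
noncomputable def laterEdges [Fintype V] (G : SimpleGraph V) (c : ℕ → V) (i : ℕ) :
    Finset (Sym2 V) := (internalFinset G).filter (· ∉ firstEdges c (i + 2))

theorem mem_laterEdges [Fintype V] {i : ℕ} {e : Sym2 V} :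
    e ∈ laterEdges G c i ↔ e ∈ internalFinset G ∧ e ∉ firstEdges c (i + 2) := mem_filter

theorem notMem_laterEdges [Fintype V] (h : PendantCycle G k c) {i j : ℕ} (hi : i + 1 < k)
    (hj : 1 ≤ j) (hji : j ≤ i + 1) : ∀ e ∈ laterEdges G c i, c j ∉ e := by
  intro e he hje
  rw [mem_laterEdges] at he
  exact he.2 (h.edge_mem_firstEdges hj (by omega) (by omega) (internalFinset_sub he.1) hje)

/-- Apart from `c 0`, such a vertex meets none of the first `i + 2` cycle edges and keeps all its
edges. The root loses only the edge to `c 1`, and keeps one off the cycle and the one to `c (k -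
1)`. -/
theorem two_le_edgeDeg_laterEdges [Fintype V] (h : PendantCycle G k c) {ctr : V → V}
    (hctr : IsLeafMap G ctr) {i : ℕ} (hi : i + 1 < k) {v : V}
    (hv : v ∈ touched (internalFinset G) (marked ctr))
    (hvc : v ∉ (Icc 1 (i + 2)).image c) : 2 ≤ edgeDeg (laterEdges G c i) v := by
  obtain ⟨hm, e, he, hve⟩ := hv
  have hb := branching_of_mem_internalFinset he hve
  have hint : ∀ y, G.Adj v y → s(v, y) ∈ internalFinset G := fun y hy =>
    mem_internalFinset.mpr (hctr.mem_internalEdges hb hm hy)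
  have hvj : ∀ j, 1 ≤ j → j ≤ i + 2 → v ≠ c j := fun j h1 h2 hvj =>
    hvc (mem_image.mpr ⟨j, mem_Icc.mpr ⟨h1, h2⟩, hvj.symm⟩)
  by_cases hv0 : v = c 0
  · subst hv0
    have hik : i + 2 < k := by
      by_contra hle
      have e : i + 2 = k := by omega
      exact hvj (i + 2) (by omega) le_rfl (by rw [e, h.closed])
    have key : ∀ y, G.Adj (c 0) y → y ≠ c 1 → s(c 0, y) ∈ laterEdges G c i := by
      intro y hy hy1
      refine mem_laterEdges.mpr ⟨hint y hy, ?_⟩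
      rw [mem_firstEdges]
      rintro ⟨j, hj, he⟩
      rcases Sym2.eq_iff.mp he with ⟨h1, h2⟩ | ⟨_, h2⟩
      · have hj0 := h.inj j 0 (by omega) (by omega) h1
        rw [hj0] at h2
        exact hy1 h2.symm
      · exact hvj (j + 1) (by omega) (by omega) h2.symm
    obtain ⟨y, hy, hy1, hyk⟩ := h.root
    have hk := h.adj (k - 1) (by omega)
    rw [show k - 1 + 1 = k by omega, h.closed] at hk
    refine two_le_edgeDeg (key y hy hy1) (key (c (k - 1)) hk.symm fun he => ?_) hyk
    have := h.inj (k - 1) 1 (by omega) (by omega) he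
    omega
  · have key : ∀ y, G.Adj v y → s(v, y) ∈ laterEdges G c i := by
      intro y hy
      refine mem_laterEdges.mpr ⟨hint y hy, ?_⟩
      rw [mem_firstEdges]
      rintro ⟨j, hj, he⟩
      have hmem : v ∈ s(c j, c (j + 1)) := by rw [he]; exact Sym2.mem_mk_left _ _
      rcases Sym2.mem_iff.mp hmem with h1 | h1
      · rcases Nat.eq_zero_or_pos j with rfl | hp
        · exact hv0 h1
        · exact hvj j hp (by omega) h1
      · exact hvj (j + 1) (by omega) (by omega) h1
    obtain ⟨a, b, ha, hb', hab⟩ := hb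
    exact two_le_edgeDeg (key a ha) (key b hb') hab

/-- Hanging the next vertex of the cycle from the one after it. -/
noncomputable def tailMap (ctr : V → V) (c : ℕ → V) (i : ℕ) : V → V :=
  Function.update ctr (c (i + 1)) (c (i + 2))

theorem ne_succ (h : PendantCycle G k c) {i : ℕ} (hi : i + 1 < k) : c (i + 1) ≠ c (i + 2) :=
  (h.adj (i + 1) hi).ne

theorem marked_tailMap (h : PendantCycle G k c) {ctr : V → V} (hctr : IsLeafMap G ctr) {i : ℕ}
    (hi : i + 1 < k) : marked (tailMap ctr c i) = insert (c (i + 2)) (marked ctr) :=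
  marked_update (h.ne_succ hi) (hctr.eq_self (h.branching (by omega)))
    (hctr.eq_self (h.branching (by omega))) (h.notMem_marked hctr (by omega) hi)

theorem touched_laterEdges [Fintype V] (h : PendantCycle G k c) {ctr : V → V}
    (hctr : IsLeafMap G ctr) {i : ℕ} (hi : i + 1 < k) :
    touched (laterEdges G c i) (marked (tailMap ctr c i)) =
      touched (internalFinset G) (marked ctr) \ ((Icc 1 (i + 2)).image c : Finset V) := by
  rw [h.marked_tailMap hctr hi]
  ext v
  constructor
  · rintro ⟨hv, e, he, hve⟩
    rw [Set.mem_insert_iff, not_or] at hv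
    refine ⟨⟨hv.2, e, (mem_laterEdges.mp he).1, hve⟩, fun hmem => ?_⟩
    obtain ⟨j, hj, rfl⟩ := mem_image.mp (mem_coe.mp hmem)
    obtain ⟨h1, h2⟩ := mem_Icc.mp hj
    rcases h2.lt_or_eq with h2 | rfl
    · exact h.notMem_laterEdges hi h1 (by omega) e he hve
    · exact hv.1 rfl
  · rintro ⟨hv, hmem⟩
    have hd := h.two_le_edgeDeg_laterEdges hctr hi hv (fun h' => hmem (mem_coe.mpr h'))
    refine ⟨?_, ?_⟩
    · rw [Set.mem_insert_iff, not_or]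
      exact ⟨fun hc => hmem (mem_coe.mpr (mem_image.mpr
        ⟨i + 2, mem_Icc.mpr ⟨by omega, le_rfl⟩, hc.symm⟩)), hv.1⟩
    · by_contra hno
      push Not at hno
      rw [edgeDeg_eq_zero hno] at hd
      omega

/-- Exactly `c 1, …, c (i + 2)` drop out. The index may reach `k`, where the vertex is the root,
hence the need for `hm`. The difference supplies the parity that offsets the sign (-1)^i in
`csf_eq_sum`. -/
theorem ncard_touched_laterEdges [Fintype V] (h : PendantCycle G k c) {ctr : V → V}
    (hctr : IsLeafMap G ctr) {i : ℕ} (hi : i + 1 < k) (hm : c (i + 2) ∉ marked ctr) :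
    (touched (laterEdges G c i) (marked (tailMap ctr c i))).ncard + (i + 2) =
      (touched (internalFinset G) (marked ctr)).ncard := by
  have hcard : (((Icc 1 (i + 2)).image c : Finset V) : Set V).ncard = i + 2 := by
    rw [Set.ncard_coe_finset, card_image_of_injOn, Nat.card_Icc]
    · omega
    · intro a ha b hb hab
      simp only [coe_Icc, Set.mem_Icc] at ha hb
      exact h.inj' ha.1 (by omega) hb.1 (by omega) hab
  rw [h.touched_laterEdges hctr hi]
  refine (congrArg _ hcard.symm).trans (Set.ncard_sdiff_add_ncard_of_subset ?_)
  intro v hv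
  obtain ⟨j, hj, rfl⟩ := mem_image.mp (mem_coe.mp hv)
  obtain ⟨h1, h2⟩ := mem_Icc.mp hj
  refine ⟨?_, s(c (j - 1), c j), ?_, Sym2.mem_mk_right _ _⟩
  · rcases h2.lt_or_eq with h2 | rfl
    · exact h.notMem_marked hctr h1 (by omega)
    · exact hm
  · have hadj := h.adj (j - 1) (by omega)
    rw [show j - 1 + 1 = j by omega] at hadj
    exact mem_internalFinset.mpr (mem_internalEdges.mpr
      ⟨hadj, h.branching (by omega), h.branching (by omega)⟩)

/-- With the edge from `c i` to `c (i + 1)` unconstrained, the next cycle edge is the only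
properness condition at `c (i + 1)`, which therefore acts as a leaf at `c (i + 2)`. -/
theorem partial_iff [Fintype V] (h : PendantCycle G k c) {ctr : V → V} (hctr : IsLeafMap G ctr)
    {i : ℕ} (hi : i + 1 < k) (κ : V → ℕ) : Partial G c i (i + 1) κ ↔
      ((∀ v, tailMap ctr c i v ≠ v → κ v ≠ κ (tailMap ctr c i v)) ∧
        ∀ e ∈ firstEdges c i, Mono κ e) ∧ ∀ e ∈ laterEdges G c i, ¬ Mono κ e := by
  have hself : ∀ j ≤ k, ctr (c j) = c j := fun j hj => hctr.eq_self (h.branching hj)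
  have hbr : ∀ {a b m}, m ≤ k → s(a, b) ∈ firstEdges c m → Branching G a := by
    intro a b m hm hmem
    obtain ⟨j, hj, he⟩ := mem_firstEdges.mp hmem
    rcases Sym2.eq_iff.mp he with ⟨h1, -⟩ | ⟨-, h1⟩
    · rw [← h1]; exact h.branching (by omega)
    · rw [← h1]; exact h.branching (by omega)
  have hn : s(c (i + 1), c (i + 2)) ∉ firstEdges c (i + 1) := by
    rw [mem_firstEdges]
    rintro ⟨j, hj, he⟩
    exact hj.ne (h.edge_inj (by omega) hi he)
  constructor
  · rintro ⟨h1, h2⟩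
    refine ⟨⟨fun v hv => ?_, h2⟩, fun e he => ?_⟩
    · by_cases hvc : v = c (i + 1)
      · rw [hvc, tailMap, Function.update_self]
        exact h1 _ _ (h.adj (i + 1) hi) hn
      · rw [tailMap, Function.update_of_ne hvc] at hv ⊢
        exact h1 _ _ (hctr.adj v hv) fun hmem =>
          hctr.not_branching v hv (hbr (m := i + 1) (by omega) hmem)
    · induction e using Sym2.ind with
      | _ a b =>
        rw [mem_laterEdges] at he
        rw [mono_mk]
        refine h1 a b (internalFinset_sub he.1) fun hmem => he.2 ?_
        obtain ⟨j, hj, he'⟩ := mem_firstEdges.mp hmem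
        exact mem_firstEdges.mpr ⟨j, by omega, he'⟩
  · rintro ⟨⟨h1, h2⟩, h3⟩
    refine ⟨fun a b hab hmem => ?_, h2⟩
    have hleaf : ∀ a b, G.Adj a b → ctr a = b → κ a ≠ κ b := by
      intro a b hab ha
      have hac : a ≠ c (i + 1) := by
        rintro rfl
        rw [hself (i + 1) (by omega)] at ha
        exact hab.ne ha
      have := h1 a
      rw [tailMap, Function.update_of_ne hac, ha] at this
      exact this hab.ne.symm
    have hnext := h1 (c (i + 1))
    rw [tailMap, Function.update_self] at hnext
    have hnext := hnext (h.ne_succ hi).symm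
    by_cases he : s(a, b) = s(c (i + 1), c (i + 2))
    · rcases Sym2.eq_iff.mp he with ⟨rfl, rfl⟩ | ⟨rfl, rfl⟩
      exacts [hnext, hnext.symm]
    · by_cases ha : ctr a = b
      · exact hleaf a b hab ha
      · by_cases hb : ctr b = a
        · exact (hleaf b a hab.symm hb).symm
        · have := h3 s(a, b) (mem_laterEdges.mpr ⟨mem_internalFinset.mpr
            (mem_internalEdges.mpr ⟨hab, hctr.branching a b hab ha hb⟩), fun hmem' => ?_⟩)
          · rwa [mono_mk] at this
          · obtain ⟨j, hj, he'⟩ := mem_firstEdges.mp hmem'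
            rcases Nat.lt_succ_iff_lt_or_eq.mp hj with hj | rfl
            · exact hmem (mem_firstEdges.mpr ⟨j, hj, he'⟩)
            · exact he he'.symm

/-- The coefficient is a separation sum over `laterEdges`, a forest because the first cycle edge is
missing, so `sepSum_forest` fixes its sign. -/
theorem exists_hasLead [Fintype V] (h : PendantCycle G k c) {ctr : V → V} (hctr : IsLeafMap G ctr)
    {i : ℕ} (hi : i + 1 < k) : ∃ a : ℚ,
      HasLead (gen (Partial G c i (i + 1))) a (starParts (tailMap ctr c i)) ∧
      0 < (-1) ^ (touched (laterEdges G c i) (marked (tailMap ctr c i))).ncard * a := by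
  have hself : ∀ j ≤ k, ctr (c j) = c j := fun j hj => hctr.eq_self (h.branching hj)
  have hunm := h.notMem_marked hctr (j := i + 1) (by omega) hi
  have hidem : ∀ v, tailMap ctr c i (tailMap ctr c i v) = tailMap ctr c i v :=
    idem_update hctr.idem (h.ne_succ hi) (hself _ (by omega)) hunm (hself _ (by omega))
  have hF : ∀ e ∈ firstEdges c i, ∀ v ∈ e, tailMap ctr c i v = v := by
    intro e he v hv
    obtain ⟨j, hj, rfl⟩ := mem_firstEdges.mp he
    obtain ⟨m, hm, rfl⟩ : ∃ m ≤ i, v = c m := by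
      rcases Sym2.mem_iff.mp hv with rfl | rfl
      exacts [⟨j, hj.le, rfl⟩, ⟨j + 1, hj, rfl⟩]
    rw [tailMap, Function.update_of_ne, hself m (by omega)]
    intro hc
    have := h.inj m (i + 1) (by omega) hi hc
    omega
  have hI : ∀ e ∈ laterEdges G c i, ∀ v ∈ e, tailMap ctr c i v = v := by
    intro e he v hv
    rw [tailMap, Function.update_of_ne]
    · exact hctr.eq_self (branching_of_mem_internalFinset (mem_laterEdges.mp he).1 hv)
    · rintro rfl
      exact h.notMem_laterEdges hi (by omega) le_rfl e he hv
  have hlead := hasLead_gen hidem _ _ hF hI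
  rw [← gen_congr (h.partial_iff hctr hi)] at hlead
  refine ⟨_, hlead, ?_⟩
  have hsum : (∑ A ∈ (laterEdges G c i).powerset,
      if Separates (firstEdges c i ∪ A) (marked (tailMap ctr c i)) then (-1 : ℚ) ^ A.card else 0) =
      sepSum (laterEdges G c i) (marked (tailMap ctr c i)) := by
    refine sum_congr rfl fun A hA => ?_
    have hS : Separates (firstEdges c i ∪ A) (marked (tailMap ctr c i)) ↔
        Separates A (marked (tailMap ctr c i)) :=
      -- Contracting `c 1, …, c i` to the root: these vertices are unmarked and on no later edge, so
      -- the monochromatic edges do not affect separation.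
      separates_union_iff (fun v => if v ∈ (Icc 1 i).image c then c 0 else v) ?_ ?_ ?_
    · simp only [hS]
    · intro u hu
      rw [if_neg]
      intro hmem
      obtain ⟨j, hj, rfl⟩ := mem_image.mp hmem
      obtain ⟨h1, h2⟩ := mem_Icc.mp hj
      rw [h.marked_tailMap hctr hi] at hu
      rcases hu with hu | hu
      · have := h.inj' h1 (by omega) (by omega) (by omega) hu
        omega
      · exact h.notMem_marked hctr h1 (by omega) hu
    · intro a b hab
      have key : ∀ m ≤ i, (if c m ∈ (Icc 1 i).image c then c 0 else c m) = c 0 := by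
        intro m hm
        rcases Nat.eq_zero_or_pos m with rfl | hp
        · exact ite_self _
        · exact if_pos (mem_image.mpr ⟨m, mem_Icc.mpr ⟨hp, hm⟩, rfl⟩)
      obtain ⟨j, hj, he⟩ := mem_firstEdges.mp hab
      rcases Sym2.eq_iff.mp he with ⟨rfl, rfl⟩ | ⟨rfl, rfl⟩
      · exact (key j hj.le).trans (key (j + 1) hj).symm
      · exact (key (j + 1) hj).trans (key j hj.le).symm
    · intro e he v hv
      rw [if_neg]
      intro hmem
      obtain ⟨j, hj, rfl⟩ := mem_image.mp hmem
      obtain ⟨h1, h2⟩ := mem_Icc.mp hj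
      exact h.notMem_laterEdges hi h1 (by omega) e (mem_powerset.mp hA he) hv
  rw [hsum, ← sepSum_compl_touched]
  have hpos := sepSum_forest (E := laterEdges G c i)
    (U := (touched (laterEdges G c i) (marked (tailMap ctr c i)))ᶜ)
    (fun e he => G.not_isDiag_of_mem_edgeSet (internalFinset_sub (mem_laterEdges.mp he).1))
    (edgeGraph_isAcyclic_of_notMem h.acyclic
      (fun e he => internalFinset_sub (mem_laterEdges.mp he).1)
      (fun he => (mem_laterEdges.mp he).2 (mem_firstEdges.mpr ⟨0, by omega, rfl⟩)))
    (fun v hv => by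
      rw [Set.mem_compl_iff, not_not, h.touched_laterEdges hctr hi] at hv
      exact h.two_le_edgeDeg_laterEdges hctr hi hv.1 fun h' => hv.2 (mem_coe.mpr h'))
  rwa [compl_compl] at hpos

theorem starParts_tailMap [Fintype V] (h : PendantCycle G k c) {ctr : V → V}
    (hctr : IsLeafMap G ctr) {i : ℕ} (hi : i + 1 < k) :
    starParts (tailMap ctr c i) + ({1} + {1 + leafCount ctr (c (i + 2))}) =
      starParts ctr + {2 + leafCount ctr (c (i + 2))} :=
  starParts_update (h.ne_succ hi) (hctr.eq_self (h.branching (by omega)))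
    (hctr.eq_self (h.branching (by omega))) (h.notMem_marked hctr (by omega) hi)

/-- Deleting the first cycle edge turns `c 1` into a leaf at `c 2`; `c 0` still branches thanks to
its edge off the cycle, so nothing else changes. -/
theorem isLeafMap_tailMap (h : PendantCycle G k c) {ctr : V → V} (hctr : IsLeafMap G ctr) :
    IsLeafMap (G.deleteEdges {s(c 0, c 1)}) (tailMap ctr c 0) := by
  have h3 := h.three_le
  have hself : ∀ j ≤ k, ctr (c j) = c j := fun j hj => hctr.eq_self (h.branching hj)
  have hunm := h.notMem_marked hctr (j := 1) (by omega) (by omega)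
  have hadj : ∀ a b, (G.deleteEdges {s(c 0, c 1)}).Adj a b ↔ G.Adj a b ∧ s(a, b) ≠ s(c 0, c 1) := by
    intro a b; rw [SimpleGraph.deleteEdges_adj]; rfl
  have hmono : ∀ v, Branching (G.deleteEdges {s(c 0, c 1)}) v → Branching G v :=
    fun v ⟨a, b, ha, hb, hab⟩ => ⟨a, b, ((hadj _ _).mp ha).1, ((hadj _ _).mp hb).1, hab⟩
  have h1nbr : ∀ y, (G.deleteEdges {s(c 0, c 1)}).Adj (c 1) y → y = c 2 := by
    intro y hy
    rw [hadj] at hy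
    rcases h.nbr 0 (by omega) y hy.1 with rfl | rfl
    · exact absurd Sym2.eq_swap hy.2
    · rfl
  have h0 : Branching (G.deleteEdges {s(c 0, c 1)}) (c 0) := by
    obtain ⟨y, hy, hy1, hyk⟩ := h.root
    have hk := h.adj (k - 1) (by omega)
    rw [show k - 1 + 1 = k by omega, h.closed] at hk
    refine ⟨y, c (k - 1), (hadj _ _).mpr ⟨hy, fun he => hy1 (Sym2.congr_right.mp he)⟩,
      (hadj _ _).mpr ⟨hk.symm, fun he => ?_⟩, hyk⟩
    have := h.inj (k - 1) 1 (by omega) (by omega) (Sym2.congr_right.mp he)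
    omega
  refine ⟨idem_update hctr.idem (h.ne_succ (i := 0) (by omega)) (hself 2 (by omega)) hunm
    (hself 1 (by omega)), fun v hv => ?_, fun v hv => ?_, ?_⟩
  · by_cases hvc : v = c 1
    · rw [hvc, tailMap, Function.update_self, hadj]
      refine ⟨h.adj 1 (by omega), fun he => ?_⟩
      rcases Sym2.eq_iff.mp he with ⟨h1, _⟩ | ⟨_, h1⟩
      · have := h.inj 1 0 (by omega) (by omega) h1; omega
      · have := h.inj 2 0 (by omega) (by omega) h1; omega
    · rw [tailMap, Function.update_of_ne hvc] at hv ⊢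
      rw [hadj]
      refine ⟨hctr.adj v hv, fun he => hctr.not_branching v hv ?_⟩
      have : v ∈ s(c 0, c 1) := by rw [← he]; exact Sym2.mem_mk_left _ _
      rcases Sym2.mem_iff.mp this with rfl | rfl
      · exact h.branching (by omega)
      · exact h.branching (by omega)
  · by_cases hvc : v = c 1
    · rintro ⟨a, b, ha, hb, hab⟩
      rw [hvc] at ha hb
      exact hab ((h1nbr a ha).trans (h1nbr b hb).symm)
    · rw [tailMap, Function.update_of_ne hvc] at hv
      exact fun hb => hctr.not_branching v hv (hmono v hb)
  · have key : ∀ a b, (G.deleteEdges {s(c 0, c 1)}).Adj a b → tailMap ctr c 0 a ≠ b →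
        tailMap ctr c 0 b ≠ a → a ≠ c 1 ∧ b ≠ c 1 := by
      intro a b hab h1 h2
      constructor
      · rintro rfl
        rw [h1nbr b hab, tailMap, Function.update_self] at h1
        exact h1 rfl
      · rintro rfl
        rw [h1nbr a hab.symm, tailMap, Function.update_self] at h2
        exact h2 rfl
    have hbr : ∀ a, a ≠ c 1 → Branching G a → Branching (G.deleteEdges {s(c 0, c 1)}) a := by
      intro a ha hb
      by_cases ha0 : a = c 0
      · rw [ha0]; exact h0
      · obtain ⟨x, y, hx, hy, hxy⟩ := hb
        have hne : ∀ z, s(a, z) ≠ s(c 0, c 1) := by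
          intro z he
          have : a ∈ s(c 0, c 1) := by rw [← he]; exact Sym2.mem_mk_left _ _
          exact (Sym2.mem_iff.mp this).elim ha0 ha
        exact ⟨x, y, (hadj _ _).mpr ⟨hx, hne x⟩, (hadj _ _).mpr ⟨hy, hne y⟩, hxy⟩
    intro a b hab h1 h2
    obtain ⟨ha, hb⟩ := key a b hab h1 h2
    rw [tailMap, Function.update_of_ne ha] at h1
    rw [tailMap, Function.update_of_ne hb] at h2
    have := hctr.branching a b ((hadj _ _).mp hab).1 h1 h2
    exact ⟨hbr a ha this.1, hbr b hb this.2⟩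

theorem isLeadingPartition [Fintype V] (h : PendantCycle G k c) :
    IsLeadingPartition (csf G) (lambdaLC (G.deleteEdges {s(c 0, c 1)})) := by
  have h3 := h.three_le
  obtain ⟨ctr, hctr⟩ := exists_isLeafMap G
  set lam := starParts (tailMap ctr c 0) with hlam
  set D := (touched (internalFinset G) (marked ctr)).ncard with hD
  have hleaf0 : ∀ {v}, ctr v = v → v ∉ marked ctr → leafCount ctr v = 0 := by
    intro v hv hm
    by_contra h0
    exact hm ((leafCount_pos hv).mp (Nat.pos_of_ne_zero h0))
  have hself : ∀ j ≤ k, ctr (c j) = c j := fun j hj => hctr.eq_self (h.branching hj)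
  have h2unm : c (0 + 2) ∉ marked ctr := h.notMem_marked hctr (by omega) (by omega)
  have hlam0 : lam + {1} + {1} = starParts ctr + {2} := by
    have := h.starParts_tailMap hctr (i := 0) (by omega)
    rw [hleaf0 (hself _ (by omega)) h2unm] at this
    rw [← this, add_assoc]
  have key : ∀ i ∈ range (k - 1), ∃ a : ℚ,
      HasLead ((-1 : ℚ) ^ i • gen (Partial G c i (i + 1))) a lam ∧ 0 ≤ (-1) ^ D * a ∧
        (i = 0 → 0 < (-1) ^ D * a) := by
    intro i hi
    have hik : i + 1 < k := by have := mem_range.mp hi; omega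
    obtain ⟨a, ha, hpos⟩ := h.exists_hasLead hctr hik
    have hparts := h.starParts_tailMap hctr hik
    -- Only the root can be marked, that is, i + 2 = k. Its star then grows from 1 + l to 2 + l with
    -- l ≥ 1, which beats forming a star of order 2, so the term is higher.
    by_cases hm : c (i + 2) ∈ marked ctr
    · refine ⟨0, ?_, by simp, fun hi0 => absurd (hi0 ▸ hm) h2unm⟩
      have hl := (leafCount_pos (hself (i + 2) (by omega))).mpr hm
      set l := leafCount ctr (c (i + 2))
      rw [hasLead_zero_iff]
      refine Submodule.smul_mem _ _ (ha.mem_higher (starParts_pos _) ?_ ?_)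
      · have e1 := congrArg Multiset.sum hparts
        have e2 := congrArg Multiset.sum hlam0
        simp only [Multiset.sum_add, Multiset.sum_singleton] at e1 e2
        omega
      · refine MultLT.of_add_right (ν := {1} + {1} + {1 + l}) ?_
        have e1 : lam + ({1} + {1} + {1 + l}) = ({2} + {1 + l}) + starParts ctr := by
          rw [← add_assoc, ← add_assoc, hlam0]; abel
        have e2 : starParts (tailMap ctr c i) + ({1} + {1} + {1 + l}) =
            ({1} + {2 + l}) + starParts ctr := by
          rw [show ({1} + {1} + {1 + l} : Multiset ℕ) = ({1} + {1 + l}) + {1} by abel, ← add_assoc,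
            hparts]; abel
        rw [e1, e2]
        refine MultLT.add_right (multLT_of_forall_lt (k := 2 + l) ?_ (by simp) ?_) _
        · intro j hj
          simp only [Multiset.mem_add, Multiset.mem_singleton] at hj
          omega
        · intro j hj
          simp only [Multiset.mem_add, Multiset.mem_singleton] at hj
          omega
    · have hcard := h.ncard_touched_laterEdges hctr hik hm
      rw [hleaf0 (hself _ (by omega)) hm] at hparts
      have heq : starParts (tailMap ctr c i) = lam := by
        rw [← hlam0, add_assoc] at hparts
        exact add_right_cancel hparts
      rw [heq] at ha
      -- As D exceeds the exponent on the right by i + 2, the factor (-1)^i is absorbed and all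
      -- these terms share the sign (-1)^D.
      have e : (-1 : ℚ) ^ D * ((-1) ^ i * a) =
          (-1) ^ (touched (laterEdges G c i) (marked (tailMap ctr c i))).ncard * a := by
        rw [hD, ← hcard, pow_add, pow_add]
        have : (-1 : ℚ) ^ i * (-1) ^ i = 1 := by rw [← mul_pow]; simp
        linear_combination ((-1) ^ (touched (laterEdges G c i)
          (marked (tailMap ctr c i))).ncard * a) * this
      exact ⟨(-1) ^ i * a, ha.smul _, by rw [e]; exact hpos.le, fun _ => by rw [e]; exact hpos⟩
  choose! a ha ha0 hapos using key
  have hlead := HasLead.sum (range (k - 1)) ha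
  rw [← h.csf_eq_sum, hlam, ← (h.isLeafMap_tailMap hctr).lambdaLC_parts] at hlead
  refine hlead.isLeadingPartition fun hz => ?_
  have hpos : 0 < ∑ i ∈ range (k - 1), (-1) ^ D * a i :=
    sum_pos' ha0 ⟨0, mem_range.mpr (by omega), hapos 0 (mem_range.mpr (by omega)) rfl⟩
  rw [← mul_sum, hz, mul_zero] at hpos
  exact lt_irrefl _ hpos

end PendantCycle

/-! ### From a unicyclic graph with one root to a pendant cycle -/

/-- Rotating, and reversing if necessary, starts the cycle at the root along either prescribed edge;
this is what covers both cycle edges at the root. -/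
theorem exists_cycle_through {V : Type*} {G : SimpleGraph V} {v₀ v w : V} {p : G.Walk v₀ v₀}
    (hp : p.IsCycle) (hvw : p.toSubgraph.Adj v w) :
    ∃ q : G.Walk v v, q.IsCycle ∧ q.toSubgraph = p.toSubgraph ∧ q.snd = w := by
  have hv : v ∈ p.support := SimpleGraph.Walk.mem_support_of_adj_toSubgraph hvw
  have hq := hp.rotate hv
  have hqs := p.toSubgraph_rotate hv
  have hw : w ∈ (p.rotate v hv).toSubgraph.neighborSet v := by rw [hqs]; exact hvw
  rw [hq.neighborSet_toSubgraph_endpoint] at hw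
  rcases hw with hw | hw
  · exact ⟨_, hq, hqs, hw.symm⟩
  · refine ⟨(p.rotate v hv).reverse, hq.reverse, ?_, ?_⟩
    · rw [SimpleGraph.Walk.toSubgraph_reverse, hqs]
    · rw [SimpleGraph.Walk.snd_reverse]; exact hw.symm

/-- An edge leaving the cycle at a vertex makes its tree non-trivial, so only the root has
neighbours other than its two cycle neighbours. -/
theorem pendantCycle_getVert {V : Type*} {G : SimpleGraph V} (hG : IsUnicyclic G) {v : V}
    {p : G.Walk v v} (hp : p.IsCycle) (hr : nontrivialRoots p.toSubgraph = {v}) :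
    PendantCycle G p.length p.getVert := by
  have h3 := hp.three_le_length
  refine ⟨h3, by simp, ?_, fun i hi => p.adj_getVert_succ hi, ?_, ?_, ?_⟩
  · intro i j hi hj hij
    exact hp.getVert_injOn' (by rw [Set.mem_ofPred_eq]; omega) (by rw [Set.mem_ofPred_eq]; omega) hij
  · intro j hj y hy
    by_cases hC : s(p.getVert (j + 1), y) ∈ p.toSubgraph.edgeSet
    · have h1 : y ∈ p.toSubgraph.neighborSet (p.getVert (j + 1)) := hC
      rw [hp.neighborSet_toSubgraph_internal (by omega) hj] at h1
      exact h1
    · have h1 := mem_nontrivialRoots (C := p.toSubgraph)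
        (p.mem_verts_toSubgraph.mpr (p.getVert_mem_support _)) hy hC
      rw [hr, Set.mem_singleton_iff, hp.getVert_endpoint_iff (by omega)] at h1
      omega
  · have hv : v ∈ nontrivialRoots p.toSubgraph := by rw [hr]; rfl
    obtain ⟨y, hy, hC⟩ := exists_adj_notMem_of_nontrivialRoots hv
    rw [SimpleGraph.Subgraph.mem_edgeSet] at hC
    refine ⟨y, by simpa using hy, ?_, ?_⟩
    · rintro rfl
      exact hC (p.toSubgraph_adj_snd hp.not_nil)
    · rintro rfl
      exact hC (p.toSubgraph_adj_penultimate hp.not_nil).symm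
  · refine hG.isAcyclic_deleteEdges hp ?_
    rw [← SimpleGraph.Walk.adj_toSubgraph_iff_mem_edges]
    exact p.toSubgraph_adj_getVert (by omega)

end StarLeading

open StarLeading in
theorem mainTheorem2 {V : Type*} [Fintype V] (G : SimpleGraph V) (hG : IsUnicyclic G)
    (C : G.Subgraph) (hC : IsCycleSubgraph C) :
    ((nontrivialRoots C).ncard = 1 →
      ∀ v ∈ nontrivialRoots C, ∀ w, C.Adj v w →
        IsLeadingPartition (csf G) (lambdaLC (G.deleteEdges {s(v, w)}))) ∧
    (2 ≤ (nontrivialRoots C).ncard → IsLeadingPartition (csf G) (lambdaLC G)) := by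
  obtain ⟨v₀, p, hp, rfl⟩ := hC
  refine ⟨fun h1 v hv w hvw => ?_, isLeadingPartition_of_two_le hG hp⟩
  obtain ⟨q, hq, hqp, rfl⟩ := exists_cycle_through hp hvw
  obtain ⟨u, hu⟩ := Set.ncard_eq_one.mp h1
  have hr : nontrivialRoots q.toSubgraph = {v} := by
    rw [hqp, hu]
    rw [hu] at hv
    rw [Set.mem_singleton_iff.mp hv]
  have h := (pendantCycle_getVert hG hq hr).isLeadingPartition
  rwa [q.getVert_zero] at h
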